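/- Let $n,d\in\mathbb N$, let $\mathcal U\subset\mathbb R^n$ be a domain (open, connected, non-empty), and let $A^j,B^{jk}:\mathcal U\to\mathbb R^{n\times n}$ ($0\le j,k\le d$) be smooth matrix families with $-B^{00}=I_n$, the coefficients of the quasilinear system $$\sum_{j=0}^d A^j(u)u_{x_j}=\sum_{j,k=0}^d\big(B^{jk}(u)u_{x_j}\big)_{x_k},\qquad x_0=t .$$ For $u\in\mathcal U$, $\xi\in\mathbb R^d$ put $$A(u,\xi)=\sum_{j=1}^dA^j(u)\xi_j,\quad B(u,\xi)=\sum_{j,k=1}^dB^{jk}(u)\xi_j\xi_k,\quad C(u,\xi)=\sum_{j=1}^d\big(B^{0j}(u)+B^{j0}(u)\big)\xi_j,$$ $$\mathcal B(u,\xi)=\begin{pmatrix}0&|\xi|I_n\\-|\xi|^{-1}B(u,\xi)&iC(u,\xi)\end{pmatrix}\ (\xi\neq0),\qquad \mathcal A(u,\xi)=\begin{pmatrix}0&0\\-iA(u,\xi)&-A^0(u)\end{pmatrix}.$$ A symbolic symmetrizer of a family $K(u,\xi)\in\mathbb C^{m\times m}$, $(u,\xi)\in\mathcal U\times(\mathbb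 R^d\setminus\{0\})$, is a smooth family $S(u,\xi)\in\mathbb C^{m\times m}$, positively homogeneous of degree $0$ in $\xi$, bounded together with all its derivatives on $\mathcal U\times\mathbb S^{d-1}$, such that for some $c>0$ and all $(u,\xi)$ one has $S=S^*\ge cI_m$ and $SK=(SK)^*$. Assume: (H$_A$) (a) There is a smooth bounded family of symmetric, uniformly positive definite matrices $\Sigma:\mathcal U\to\mathbb R^{n\times n}$ such that $\Sigma(u)A^0(u)$ is symmetric and uniformly positive definite on $\mathcal U$; (b) $A^0(u)^{-1}A(u,\xi)$ has a symbolic symmetrizer $H(u,\xi)$. (H$_B$) $i\mathcal B(u,\xi)$ has a symbolic symmetrizer $\mathcal H(u,\xi)$. (D) At a fixed state $\bar u\in\mathcal U$: (D1) with $W_0=(A^0)^{-1}A(\omega)$ and $W_1=H(\omega)(A^0)^{-1}\big(-B(\omega)+(A^0)^{-1}A(\omega)(A^0)^{-1}A(\omega)+C(\omega)(A^0)^{-1}A(\omega)\big)$, all evaluated at $u=\bar u$, there is $\bar c>0$ such that $v^*(W_1+W_1^*)v\le-\bar c|v|^2$ for every $\omega\in\mathbb S^{d-1}$ and every $v\in\mathbb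 C^n$ in an eigenspace of $W_0$; (D2) there is $\bar c>0$ such that, with $\mathcal W_1=\mathcal H(\bar u,\omega)\mathcal A(\bar u,\omega)$, $v^*(\mathcal W_1+\mathcal W_1^*)v\le-\bar c|v|^2$ for every $\omega\in\mathbb S^{d-1}$ and every $v\in\mathbb C^{2n}$ in an eigenspace of $\mathcal B(\bar u,\omega)$; (D3) all solutions $(\lambda,\xi)\in\mathbb C\times(\mathbb R^d\setminus\{0\})$ of the dispersion relation of the system linearized at $\bar u$, $\det\big(\lambda^2I_n+\lambda(A^0(\bar u)-iC(\bar u,\xi))+iA(\bar u,\xi)+B(\bar u,\xi)\big)=0$, satisfy $\operatorname{Re}\lambda<0$. Let $\langle\xi\rangle=(1+|\xi|^2)^{1/2}$, $\mathcal Z(\xi)=\operatorname{diag}(\langle\xi\rangle I_n,I_n)$ and $$\mathcal M(u,\xi)=\mathcal Z(\xi)\begin{pmatrix}0&I_n\\-iA(u,\xi)-B(u,\xi)&iC(u,\xi)-A^0(u)\end{pmatrix}\mathcal Z(\xi)^{-1}.$$ **Proposition.** There exist $c>0$ and a family $\xi\mapsto\mathcal T(\xi)$, $\mathbb R^d\to\mathbb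 C^{2n\times2n}$, of invertible matrices such that $\mathcal T(\xi)$ and $\mathcal T(\xi)^{-1}$ are bounded uniformly in $\xi$ and, for all $\xi\in\mathbb R^d$, $$\mathcal T(\xi)\mathcal M(\bar u,\xi)\mathcal T(\xi)^{-1}+\big(\mathcal T(\xi)\mathcal M(\bar u,\xi)\mathcal T(\xi)^{-1}\big)^*\le-c\,\frac{|\xi|^2}{1+|\xi|^2}\,I_{2n}.$$ (Without loss of generality one may take $\bar u=0$, giving the inequality for $\mathcal M(0,\xi)$.) -/

import Mathlib

open Matrix
open scoped ContDiff ComplexOrder MatrixOrder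

noncomputable section

/-- `ℝᵐ` with the Euclidean norm. -/
abbrev RVec (m : ℕ) : Type := EuclideanSpace ℝ (Fin m)

/-- A real matrix regarded as a complex one. -/
def toCMat {ι : Type*} (M : Matrix ι ι ℝ) : Matrix ι ι ℂ :=
  M.map (fun x : ℝ => (x : ℂ))

/-- `S` is a symbolic symmetrizer for the matrix family `K` on `U × (ℝᵈ ∖ {0})`.
Smoothness and boundedness of matrix-valued maps are expressed entrywise, and `≤` between
hermitian matrices is the Loewner order (`X ≤ Y` iff `Y - X` is positive semidefinite). -/
structure IsSymbolicSymmetrizer {n d : ℕ} {ι : Type} [Fintype ι] [DecidableEq ι]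
    (U : Set (RVec n)) (K S : RVec n → RVec d → Matrix ι ι ℂ) : Prop where
  smooth : ∀ i j, ContDiffOn ℝ ∞ (fun p : RVec n × RVec d => S p.1 p.2 i j) (U ×ˢ {0}ᶜ)
  homogeneous : ∀ u ∈ U, ∀ ξ : RVec d, ξ ≠ 0 → ∀ t : ℝ, 0 < t → S u (t • ξ) = S u ξ
  /-- All derivatives (of order `k = 0, 1, 2, …`) are bounded on `U × 𝕊ᵈ⁻¹`. -/
  bounded : ∀ k : ℕ, ∃ C : ℝ, ∀ u ∈ U, ∀ w : RVec d, ‖w‖ = 1 → ∀ i j,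
    ‖iteratedFDeriv ℝ k (fun p : RVec n × RVec d => S p.1 p.2 i j) (u, w)‖ ≤ C
  hermitian : ∀ u ∈ U, ∀ ξ : RVec d, ξ ≠ 0 → (S u ξ).IsHermitian
  uniformly_pos : ∃ c : ℝ, 0 < c ∧ ∀ u ∈ U, ∀ ξ : RVec d, ξ ≠ 0 →
    (c : ℂ) • (1 : Matrix ι ι ℂ) ≤ S u ξ
  symmetrizes : ∀ u ∈ U, ∀ ξ : RVec d, ξ ≠ 0 → (S u ξ * K u ξ).IsHermitian

/-- The quadratic form of `W₁ + W₁*`, restricted to any eigenspace of `W₀`, is at most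
`-c |v|²`. -/
def NegOnEigenspaces {ι : Type} [Fintype ι] [DecidableEq ι]
    (W₀ W₁ : Matrix ι ι ℂ) (c : ℝ) : Prop :=
  ∀ (μ : ℂ) (v : ι → ℂ), W₀ *ᵥ v = μ • v →
    (star v ⬝ᵥ ((W₁ + W₁ᴴ) *ᵥ v)).re ≤ -c * (star v ⬝ᵥ v).re

/-- The coefficients of the quasilinear system
`∑_{j=0}^d A^j(u) u_{x_j} = ∑_{j,k=0}^d (B^{jk}(u) u_{x_j})_{x_k}`, `x_0 = t`,
for `u` with values in a domain `U ⊆ ℝⁿ`: smooth real matrix families, normalized so that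
`-B^{00} = I_n`. -/
structure QuasilinearSystem (n d : ℕ) where
  U : Set (RVec n)
  isOpen_U : IsOpen U
  isConnected_U : IsConnected U
  A : Fin (d + 1) → RVec n → Matrix (Fin n) (Fin n) ℝ
  B : Fin (d + 1) → Fin (d + 1) → RVec n → Matrix (Fin n) (Fin n) ℝ
  smooth_A : ∀ j a b, ContDiffOn ℝ ∞ (fun u => A j u a b) U
  smooth_B : ∀ j k a b, ContDiffOn ℝ ∞ (fun u => B j k u a b) U
  B_zero_zero : ∀ u ∈ U, -B 0 0 u = 1

namespace QuasilinearSystem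

variable {n d : ℕ} (P : QuasilinearSystem n d)

/-- `A⁰(u)`, as a complex matrix. -/
def A0 (u : RVec n) : Matrix (Fin n) (Fin n) ℂ := toCMat (P.A 0 u)

/-- `A(u, ξ) = ∑_{j=1}^d A^j(u) ξ_j`. -/
def symA (u : RVec n) (ξ : RVec d) : Matrix (Fin n) (Fin n) ℂ :=
  toCMat (∑ j : Fin d, ξ j • P.A j.succ u)

/-- `B(u, ξ) = ∑_{j,k=1}^d B^{jk}(u) ξ_j ξ_k`. -/
def symB (u : RVec n) (ξ : RVec d) : Matrix (Fin n) (Fin n) ℂ :=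
  toCMat (∑ j : Fin d, ∑ k : Fin d, (ξ j * ξ k) • P.B j.succ k.succ u)

/-- `C(u, ξ) = ∑_{j=1}^d (B^{0j}(u) + B^{j0}(u)) ξ_j`. -/
def symC (u : RVec n) (ξ : RVec d) : Matrix (Fin n) (Fin n) ℂ :=
  toCMat (∑ j : Fin d, ξ j • (P.B 0 j.succ u + P.B j.succ 0 u))

/-- The matrix `[[0, |ξ| I], [-|ξ|⁻¹ B(u, ξ), i C(u, ξ)]]`. -/
def calB (u : RVec n) (ξ : RVec d) : Matrix (Fin n ⊕ Fin n) (Fin n ⊕ Fin n) ℂ :=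
  Matrix.fromBlocks 0 ((‖ξ‖ : ℂ) • 1)
    (-((‖ξ‖ : ℂ)⁻¹ • P.symB u ξ)) (Complex.I • P.symC u ξ)

/-- The matrix `[[0, 0], [-i A(u, ξ), -A⁰(u)]]`. -/
def calA (u : RVec n) (ξ : RVec d) : Matrix (Fin n ⊕ Fin n) (Fin n ⊕ Fin n) ℂ :=
  Matrix.fromBlocks 0 0 (-(Complex.I • P.symA u ξ)) (-P.A0 u)

/-- Condition (H_A), with symbolic symmetrizer `H` of `A⁰(u)⁻¹ A(u, ξ)`. -/
structure CondHA (H : RVec n → RVec d → Matrix (Fin n) (Fin n) ℂ) : Prop where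
  exists_sigma : ∃ Sig : RVec n → Matrix (Fin n) (Fin n) ℝ,
    (∀ a b, ContDiffOn ℝ ∞ (fun u => Sig u a b) P.U) ∧
    (∃ C : ℝ, ∀ u ∈ P.U, ∀ a b, |Sig u a b| ≤ C) ∧
    (∀ u ∈ P.U, (Sig u).IsSymm) ∧
    (∃ c : ℝ, 0 < c ∧ ∀ u ∈ P.U, c • (1 : Matrix (Fin n) (Fin n) ℝ) ≤ Sig u) ∧
    (∀ u ∈ P.U, (Sig u * P.A 0 u).IsSymm) ∧
    (∃ c : ℝ, 0 < c ∧ ∀ u ∈ P.U, c • (1 : Matrix (Fin n) (Fin n) ℝ) ≤ Sig u * P.A 0 u)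
  symmetrizer : IsSymbolicSymmetrizer P.U (fun u ξ => (P.A0 u)⁻¹ * P.symA u ξ) H

/-- Condition (H_B), with symbolic symmetrizer `HH` of `i 𝓑(u, ξ)`. -/
def CondHB (HH : RVec n → RVec d → Matrix (Fin n ⊕ Fin n) (Fin n ⊕ Fin n) ℂ) : Prop :=
  IsSymbolicSymmetrizer P.U (fun u ξ => Complex.I • P.calB u ξ) HH

/-- `W₀ = A⁰⁻¹ A(w)` at the state `u`. -/
def W0 (u : RVec n) (w : RVec d) : Matrix (Fin n) (Fin n) ℂ :=
  (P.A0 u)⁻¹ * P.symA u w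

/-- `W₁ = H(w) A⁰⁻¹ (-B(w) + A⁰⁻¹ A(w) A⁰⁻¹ A(w) + C(w) A⁰⁻¹ A(w))` at the state `u`. -/
def W1 (H : RVec n → RVec d → Matrix (Fin n) (Fin n) ℂ) (u : RVec n) (w : RVec d) :
    Matrix (Fin n) (Fin n) ℂ :=
  H u w * (P.A0 u)⁻¹ *
    (-P.symB u w + (P.A0 u)⁻¹ * P.symA u w * (P.A0 u)⁻¹ * P.symA u w
      + P.symC u w * (P.A0 u)⁻¹ * P.symA u w)

/-- The frequencies `p = (λ, i ξ_1, …, i ξ_d)` of the plane wave `exp(λ t + i ξ·x)`. -/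
def freq (lam : ℂ) (ξ : RVec d) : Fin (d + 1) → ℂ :=
  Fin.cons lam (fun j => Complex.I * (ξ j : ℂ))

/-- The matrix `∑_j p_j A^j(u) - ∑_{j,k} p_j p_k B^{jk}(u)`: `exp(λ t + i ξ·x) v` solves the
system linearized at the constant state `u` iff this matrix annihilates `v`. -/
def dispersionMatrix (u : RVec n) (lam : ℂ) (ξ : RVec d) : Matrix (Fin n) (Fin n) ℂ :=
  (∑ j, freq lam ξ j • toCMat (P.A j u))
    - ∑ j, ∑ k, (freq lam ξ j * freq lam ξ k) • toCMat (P.B j k u)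

/-- Condition (D) at the state `ubar`, for the symmetrizers `H`, `HH` of (H_A), (H_B). -/
structure CondD (H : RVec n → RVec d → Matrix (Fin n) (Fin n) ℂ)
    (HH : RVec n → RVec d → Matrix (Fin n ⊕ Fin n) (Fin n ⊕ Fin n) ℂ)
    (ubar : RVec n) : Prop where
  D1 : ∃ c : ℝ, 0 < c ∧ ∀ w : RVec d, ‖w‖ = 1 →
    NegOnEigenspaces (P.W0 ubar w) (P.W1 H ubar w) c
  D2 : ∃ c : ℝ, 0 < c ∧ ∀ w : RVec d, ‖w‖ = 1 →
    NegOnEigenspaces (P.calB ubar w) (HH ubar w * P.calA ubar w) c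
  D3 : ∀ (lam : ℂ) (ξ : RVec d), ξ ≠ 0 → (P.dispersionMatrix ubar lam ξ).det = 0 → lam.re < 0

/-- The Fourier symbol `[[0, I], [-i A(u, ξ) - B(u, ξ), i C(u, ξ) - A⁰(u)]]` of the system
written as a first-order system in time for `(u, u_t)`. -/
def symMbar (u : RVec n) (ξ : RVec d) : Matrix (Fin n ⊕ Fin n) (Fin n ⊕ Fin n) ℂ :=
  Matrix.fromBlocks 0 1
    (-(Complex.I • P.symA u ξ) - P.symB u ξ) (Complex.I • P.symC u ξ - P.A0 u)

/-- `𝓩(ξ) = diag(⟨ξ⟩ I, I)` with `⟨ξ⟩ = (1 + |ξ|²)^{1/2}`. -/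
def calZ (n : ℕ) {d : ℕ} (ξ : RVec d) : Matrix (Fin n ⊕ Fin n) (Fin n ⊕ Fin n) ℂ :=
  Matrix.fromBlocks ((Real.sqrt (1 + ‖ξ‖ ^ 2) : ℂ) • 1) 0 0 1

/-- `𝓜(u, ξ) = 𝓩(ξ) 𝓜bar(u, ξ) 𝓩(ξ)⁻¹`. -/
def symM (u : RVec n) (ξ : RVec d) : Matrix (Fin n ⊕ Fin n) (Fin n ⊕ Fin n) ℂ :=
  calZ n ξ * P.symMbar u ξ * (calZ n ξ)⁻¹

end QuasilinearSystem

end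

/-! A bounded change of variables `T` making `M` dissipative amounts to a hermitian form `G = Tᴴ *
T` with `κ ≤ G ≤ κ⁻¹` and `G * M + Mᴴ * G ≤ -κρ` (`HasLyapunov`, `HasLyapunov.exists_conj`). No
regularity in ξ is required, so it is enough to build `G` locally with a local constant, and
compactness makes the constant uniform (`exists_hasLyapunov_of_isCompact`).

On compact sets avoiding ξ = 0, (D3) puts the spectrum in the open left half plane and Lyapunov's
theorem applies (`exists_lyapunov_of_stable`). The limits |ξ| → ∞ and |ξ| → 0 are treated in polar
coordinates, near each direction on the sphere.

For |ξ| → ∞ the symbol in the variables (|ξ|u, u_t) is |ξ|𝓑 + 𝓐. The symmetrizer of i𝓑 cancels the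
leading term exactly; the remaining form is negative only on eigenspaces of 𝓑, by (D2). A correction
|ξ|⁻¹K of the energy contributes a commutator with 𝓑 that removes the part of the form mixing
different eigenspaces (`exists_compensator`).

For |ξ| → 0 there are n fast modes, damped by A⁰, and n slow modes governed by -i|ξ|W₀ + |ξ|²V up to
third order, where HV = W₁. After separating them (`slowFast_intertwines`), the slow block is
handled by (D1) and a compensator, giving decay of order |ξ|²; a large weight on the fast block
absorbs the coupling (`eventually_hasLyapunov_low`).

In both limits K is frozen at the limiting direction: the exact cancellations use only the
symmetrizer, and K enters only strict inequalities that survive small perturbations. Crossing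
eigenvalues therefore do no harm. -/

noncomputable section

open Filter Topology

/-! ### Loewner bounds and their stability under limits -/

section LoewnerOrder

variable {ι X : Type*} [Fintype ι] [DecidableEq ι]

open scoped Matrix.Norms.L2Operator in
theorem Matrix.PosDef.exists_smul_one_le {N : Matrix ι ι ℂ} (hN : N.PosDef) :
    ∃ c : ℝ, 0 < c ∧ c • (1 : Matrix ι ι ℂ) ≤ N := by
  rcases isEmpty_or_nonempty ι with h | h
  · exact ⟨1, one_pos, le_of_eq (Subsingleton.elim _ _)⟩
  have := (CFC.exists_pos_algebraMap_le_iff (A := Matrix ι ι ℂ) (a := N) hN.isHermitian).2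
  simp only [Algebra.algebraMap_eq_smul_one] at this
  refine this fun x hx => ?_
  rw [hN.isHermitian.spectrum_real_eq_range_eigenvalues] at hx
  obtain ⟨i, rfl⟩ := hx
  exact hN.eigenvalues_pos i

open scoped Matrix.Norms.L2Operator in
theorem Matrix.IsHermitian.le_norm_smul_one {N : Matrix ι ι ℂ} (hN : N.IsHermitian) :
    N ≤ ‖N‖ • (1 : Matrix ι ι ℂ) := by
  have := IsSelfAdjoint.le_algebraMap_norm_self (a := N) hN
  rwa [Algebra.algebraMap_eq_smul_one] at this

-- A hermitian perturbation is bounded by its norm times the identity, so half of the lower bound of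
-- the limit survives.
open scoped Matrix.Norms.L2Operator in
theorem eventually_smul_one_le {l : Filter X} {N : X → Matrix ι ι ℂ} {N₀ : Matrix ι ι ℂ}
    (h : Tendsto N l (𝓝 N₀)) (hN₀ : N₀.PosDef) (hN : ∀ᶠ x in l, (N x).IsHermitian) :
    ∃ c : ℝ, 0 < c ∧ ∀ᶠ x in l, c • (1 : Matrix ι ι ℂ) ≤ N x := by
  obtain ⟨c, hc, hcN⟩ := hN₀.exists_smul_one_le
  refine ⟨c / 2, by positivity, ?_⟩
  have h1 : ∀ᶠ x in l, ‖N₀ - N x‖ < c / 2 := by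
    have : Tendsto (fun x => ‖N₀ - N x‖) l (𝓝 ‖N₀ - N₀‖) := (tendsto_const_nhds.sub h).norm
    rw [sub_self, norm_zero] at this
    exact this.eventually_lt_const (by positivity)
  filter_upwards [h1, hN] with x hx hxN
  have h2 : N₀ - N x ≤ (c / 2) • (1 : Matrix ι ι ℂ) :=
    (hN₀.isHermitian.sub hxN).le_norm_smul_one.trans
      (smul_le_smul_of_nonneg_right hx.le zero_le_one)
  calc (c / 2) • (1 : Matrix ι ι ℂ) = c • 1 - (c / 2) • 1 := by module
    _ ≤ N₀ - (N₀ - N x) := sub_le_sub hcN h2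
    _ = N x := by abel

open scoped Matrix.Norms.L2Operator in
theorem eventually_le_smul_one {l : Filter X} {N : X → Matrix ι ι ℂ} {N₀ : Matrix ι ι ℂ}
    (h : Tendsto N l (𝓝 N₀)) (hN : ∀ᶠ x in l, (N x).IsHermitian) :
    ∃ c : ℝ, 0 < c ∧ ∀ᶠ x in l, N x ≤ c • (1 : Matrix ι ι ℂ) := by
  refine ⟨‖N₀‖ + 1, by positivity, ?_⟩
  filter_upwards [h.norm.eventually_lt_const (lt_add_one ‖N₀‖), hN] with x hx hxN
  exact hxN.le_norm_smul_one.trans (smul_le_smul_of_nonneg_right hx.le zero_le_one)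

omit [DecidableEq ι] in
theorem conjTranspose_mul_mul_le {A B : Matrix ι ι ℂ} (h : A ≤ B) (F : Matrix ι ι ℂ) :
    Fᴴ * A * F ≤ Fᴴ * B * F := star_left_conjugate_le_conjugate h F

theorem smul_conjTranspose_mul_self_le {A : Matrix ι ι ℂ} {c : ℝ} (h : c • 1 ≤ A)
    (F : Matrix ι ι ℂ) : c • (Fᴴ * F) ≤ Fᴴ * A * F := by
  simpa using conjTranspose_mul_mul_le h F

omit [Fintype ι] in
theorem posDef_of_smul_one_le {N : Matrix ι ι ℂ} {c : ℝ} (hc : 0 < c)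
    (h : c • (1 : Matrix ι ι ℂ) ≤ N) : N.PosDef := by
  have h1 : (c • (1 : Matrix ι ι ℂ)).PosDef := by
    have : ((c : ℂ) • (1 : Matrix ι ι ℂ)).PosDef :=
      PosDef.one.smul (by exact_mod_cast hc)
    simpa using this
  simpa using h1.add_posSemidef (Matrix.le_iff.1 h)

end LoewnerOrder

/-! ### Lyapunov matrices: transport, localization, and the resulting change of variables -/

/-- `M` admits a Lyapunov matrix `G` with bounds `κ ≤ G ≤ κ⁻¹` and decay rate `κ * ρ`. -/
def HasLyapunov {ι : Type*} [Fintype ι] [DecidableEq ι] (κ ρ : ℝ) (M : Matrix ι ι ℂ) : Prop :=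
  ∃ G : Matrix ι ι ℂ, κ • 1 ≤ G ∧ κ • G ≤ 1 ∧ G * M + Mᴴ * G ≤ -((κ * ρ) • (1 : Matrix ι ι ℂ))

section Lyapunov

variable {ι X : Type*} [Fintype ι] [DecidableEq ι]

theorem HasLyapunov.mono {κ κ' ρ : ℝ} {M : Matrix ι ι ℂ} (h : HasLyapunov κ ρ M)
    (hκ' : 0 < κ') (hκ : κ' ≤ κ) (hρ : 0 ≤ ρ) : HasLyapunov κ' ρ M := by
  obtain ⟨G, h1, h2, h3⟩ := h
  have hG : 0 ≤ G := (smul_nonneg (hκ'.le.trans hκ) zero_le_one).trans h1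
  exact ⟨G, (smul_le_smul_of_nonneg_right hκ zero_le_one).trans h1,
    (smul_le_smul_of_nonneg_right hκ hG).trans h2,
    h3.trans (neg_le_neg (smul_le_smul_of_nonneg_right
      (mul_le_mul_of_nonneg_right hκ hρ) zero_le_one))⟩

/-- Lyapunov matrices persist under a change of coordinates `S` with `a ≤ S* S ≤ a⁻¹`. -/
theorem HasLyapunov.conj {κ ρ a : ℝ} {M M' S : Matrix ι ι ℂ} (h : HasLyapunov κ ρ M)
    (hκ : 0 < κ) (hρ : 0 ≤ ρ) (ha : 0 < a) (hS : S * M' = M * S)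
    (h1 : a • 1 ≤ Sᴴ * S) (h2 : a • (Sᴴ * S) ≤ 1) :
    HasLyapunov (κ * a) ρ M' := by
  obtain ⟨G, g1, g2, g3⟩ := h
  refine ⟨Sᴴ * G * S, ?_, ?_, ?_⟩
  · calc (κ * a) • (1 : Matrix ι ι ℂ) = κ • a • 1 := by rw [mul_smul]
      _ ≤ κ • (Sᴴ * S) := smul_le_smul_of_nonneg_left h1 hκ.le
      _ ≤ _ := smul_conjTranspose_mul_self_le g1 S
  · calc (κ * a) • (Sᴴ * G * S) = a • (Sᴴ * (κ • G) * S) := by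
          simp [mul_smul, smul_comm κ a]
      _ ≤ a • (Sᴴ * 1 * S) :=
          smul_le_smul_of_nonneg_left (conjTranspose_mul_mul_le g2 S) ha.le
      _ ≤ 1 := by simpa using h2
  · have e : Sᴴ * G * S * M' + M'ᴴ * (Sᴴ * G * S) = Sᴴ * (G * M + Mᴴ * G) * S := by
      have hS' := congrArg conjTranspose hS
      simp only [conjTranspose_mul] at hS'
      calc _ = Sᴴ * G * (S * M') + (M'ᴴ * Sᴴ) * G * S := by simp only [mul_assoc]
        _ = _ := by rw [hS, hS']; noncomm_ring
    rw [e]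
    calc _ ≤ Sᴴ * (-((κ * ρ) • 1)) * S := conjTranspose_mul_mul_le g3 S
      _ = -((κ * ρ) • (Sᴴ * S)) := by simp
      _ ≤ -((κ * ρ) • (a • 1)) :=
        neg_le_neg (smul_le_smul_of_nonneg_left h1 (by positivity))
      _ = _ := by rw [smul_smul]; congr 2; ring

/-- Common frame for all frequency regimes: positivity is checked only on the limits of `G` and `N`,
while a rate that degenerates in the limit is carried by the factor `F`. -/
theorem eventually_hasLyapunov {l : Filter X} {M G N F : X → Matrix ι ι ℂ}
    {G₀ N₀ : Matrix ι ι ℂ} {ρ : X → ℝ} (hρ : ∀ x, 0 ≤ ρ x)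
    (hG : Tendsto G l (𝓝 G₀)) (hG₀ : G₀.PosDef) (hGh : ∀ᶠ x in l, (G x).IsHermitian)
    (hN : Tendsto N l (𝓝 N₀)) (hN₀ : N₀.PosDef) (hNh : ∀ᶠ x in l, (N x).IsHermitian)
    (hF : ∃ a : ℝ, 0 < a ∧ ∀ᶠ x in l, (a * ρ x) • (1 : Matrix ι ι ℂ) ≤ (F x)ᴴ * F x)
    (hM : ∀ᶠ x in l, G x * M x + (M x)ᴴ * G x = -((F x)ᴴ * N x * F x)) :
    ∃ κ : ℝ, 0 < κ ∧ ∀ᶠ x in l, HasLyapunov κ (ρ x) (M x) := by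
  obtain ⟨a, ha, hF⟩ := hF
  obtain ⟨c, hc, hcG⟩ := eventually_smul_one_le hG hG₀ hGh
  obtain ⟨b, hb, hbN⟩ := eventually_smul_one_le hN hN₀ hNh
  obtain ⟨C, hC, hCG⟩ := eventually_le_smul_one hG hGh
  -- The three entries serve the lower bound of `G`, its upper bound and the decay rate,
  -- respectively.
  set κ := min c (min C⁻¹ (b * a))
  have hκ : 0 < κ := by positivity
  refine ⟨κ, hκ, ?_⟩
  filter_upwards [hF, hcG, hbN, hCG, hM] with x h1 h2 h3 h4 h5
  refine ⟨G x, (smul_le_smul_of_nonneg_right (min_le_left _ _) zero_le_one).trans h2, ?_, ?_⟩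
  · calc κ • G x ≤ κ • C • (1 : Matrix ι ι ℂ) := smul_le_smul_of_nonneg_left h4 hκ.le
      _ = (κ * C) • 1 := smul_smul _ _ _
      _ ≤ (C⁻¹ * C) • 1 := smul_le_smul_of_nonneg_right (mul_le_mul_of_nonneg_right
          ((min_le_right _ _).trans (min_le_left _ _)) hC.le) zero_le_one
      _ = 1 := by rw [inv_mul_cancel₀ hC.ne', one_smul]
  · rw [h5]
    refine neg_le_neg ?_
    calc (κ * ρ x) • (1 : Matrix ι ι ℂ) ≤ (b * a * ρ x) • 1 :=
          smul_le_smul_of_nonneg_right (mul_le_mul_of_nonneg_right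
            ((min_le_right _ _).trans (min_le_right _ _)) (hρ x)) zero_le_one
      _ = b • (a * ρ x) • 1 := by rw [smul_smul, mul_assoc]
      _ ≤ b • ((F x)ᴴ * F x) := smul_le_smul_of_nonneg_left h1 hb.le
      _ ≤ _ := smul_conjTranspose_mul_self_le h3 _

/-- A uniform local Lyapunov property on a compact set is a uniform one. -/
theorem exists_hasLyapunov_of_isCompact [TopologicalSpace X] {s t : Set X} (hs : IsCompact s)
    {M : X → Matrix ι ι ℂ} {ρ : X → ℝ} (hρ : ∀ x, 0 ≤ ρ x)
    (h : ∀ x₀ ∈ s, ∃ κ : ℝ, 0 < κ ∧ ∀ᶠ x in 𝓝 x₀, x ∈ t → HasLyapunov κ (ρ x) (M x)) :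
    ∃ κ : ℝ, 0 < κ ∧ ∀ᶠ x in 𝓝ˢ s, x ∈ t → HasLyapunov κ (ρ x) (M x) := by
  refine hs.induction_on
    (p := fun s' => ∃ κ : ℝ, 0 < κ ∧ ∀ᶠ x in 𝓝ˢ s', x ∈ t → HasLyapunov κ (ρ x) (M x)) ?_ ?_ ?_ ?_
  · exact ⟨1, one_pos, by simp⟩
  · rintro s₁ s₂ h12 ⟨κ, hκ, h⟩
    exact ⟨κ, hκ, h.filter_mono (nhdsSet_mono h12)⟩
  · rintro s₁ s₂ ⟨κ₁, hκ₁, h₁⟩ ⟨κ₂, hκ₂, h₂⟩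
    refine ⟨min κ₁ κ₂, by positivity, ?_⟩
    rw [nhdsSet_union, eventually_sup]
    exact ⟨h₁.mono fun x hx ht => (hx ht).mono (by positivity) (min_le_left _ _) (hρ x),
      h₂.mono fun x hx ht => (hx ht).mono (by positivity) (min_le_right _ _) (hρ x)⟩
  · intro x hx
    obtain ⟨κ, hκ, h⟩ := h x hx
    obtain ⟨V, hV, hVo, hxV⟩ := eventually_nhds_iff.1 h
    refine ⟨V, mem_nhdsWithin_of_mem_nhds (hVo.mem_nhds hxV), κ, hκ, ?_⟩
    rw [hVo.nhdsSet_eq]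
    exact hV

/-- A Lyapunov matrix yields a bounded change of coordinates with dissipative symbol. -/
theorem HasLyapunov.exists_conj {κ ρ : ℝ} {M : Matrix ι ι ℂ} (h : HasLyapunov κ ρ M)
    (hκ : 0 < κ) (hρ : 0 ≤ ρ) :
    ∃ T : Matrix ι ι ℂ, IsUnit T ∧ (∀ i j, ‖T i j‖ ≤ √(κ⁻¹) ∧ ‖T⁻¹ i j‖ ≤ √(κ⁻¹)) ∧
      T * M * T⁻¹ + (T * M * T⁻¹)ᴴ ≤ -((κ * κ * ρ) • (1 : Matrix ι ι ℂ)) := by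
  -- The diagonal entry `(Tᴴ * T) j j` is the squared norm of column `j`, which dominates each of
  -- its entries.
  have bound : ∀ T : Matrix ι ι ℂ, κ • (Tᴴ * T) ≤ 1 → ∀ i j, ‖T i j‖ ≤ √(κ⁻¹) := by
    intro T hT i j
    have h1 := (Matrix.le_iff.1 hT).diag_nonneg (i := j)
    have h2 : (((κ * ∑ k, ‖T k j‖ ^ 2 : ℝ)) : ℂ) = κ * (Tᴴ * T) j j := by
      simp [Matrix.mul_apply, Complex.conj_mul']
    have h3 : κ * ∑ k, ‖T k j‖ ^ 2 ≤ 1 := by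
      have : (0 : ℂ) ≤ 1 - κ * (Tᴴ * T) j j := by simpa using h1
      rw [← h2] at this
      have : (0 : ℝ) ≤ 1 - κ * ∑ k, ‖T k j‖ ^ 2 := by exact_mod_cast this
      linarith
    refine Real.le_sqrt_of_sq_le ?_
    rw [← one_div, le_div_iff₀' hκ]
    refine le_trans ?_ h3
    gcongr
    exact Finset.single_le_sum (f := fun k => ‖T k j‖ ^ 2) (fun k _ => by positivity)
      (Finset.mem_univ i)
  obtain ⟨G, g1, g2, g3⟩ := h
  have hGp := posDef_of_smul_one_le hκ g1
  obtain ⟨T, rfl⟩ := CStarAlgebra.nonneg_iff_eq_star_mul_self.1 hGp.posSemidef.nonneg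
  simp only [star_eq_conjTranspose] at g1 g2 g3 hGp
  have hT : IsUnit T := by
    have := hGp.isUnit
    rw [Matrix.isUnit_iff_isUnit_det, Matrix.det_mul] at this
    exact (Matrix.isUnit_iff_isUnit_det _).2 (isUnit_of_mul_isUnit_right this)
  have hdet := (Matrix.isUnit_iff_isUnit_det _).1 hT
  have i1 : T * T⁻¹ = 1 := Matrix.mul_nonsing_inv _ hdet
  have i2 : (T⁻¹)ᴴ * Tᴴ = 1 := by rw [← conjTranspose_mul, i1, conjTranspose_one]
  have e1 : (T⁻¹)ᴴ * (Tᴴ * T) * T⁻¹ = 1 := by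
    calc _ = ((T⁻¹)ᴴ * Tᴴ) * (T * T⁻¹) := by simp only [mul_assoc]
      _ = 1 := by rw [i1, i2, one_mul]
  refine ⟨T, hT, fun i j => ⟨bound T g2 i j, bound _ ?_ i j⟩, ?_⟩
  · have := smul_conjTranspose_mul_self_le g1 T⁻¹
    rwa [e1] at this
  · have e2 : T * M * T⁻¹ + (T * M * T⁻¹)ᴴ =
        (T⁻¹)ᴴ * ((Tᴴ * T) * M + Mᴴ * (Tᴴ * T)) * T⁻¹ := by
      calc _ = ((T⁻¹)ᴴ * Tᴴ) * T * M * T⁻¹ + (T⁻¹)ᴴ * Mᴴ * Tᴴ * (T * T⁻¹) := by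
            rw [i1, i2]; simp [mul_assoc]
        _ = _ := by noncomm_ring
    rw [e2]
    -- Conjugation by `T⁻¹` turns the upper bound on `G` into a lower bound; this costs the second
    -- factor `κ` in the rate.
    have e3 : κ • (1 : Matrix ι ι ℂ) ≤ (T⁻¹)ᴴ * T⁻¹ := by
      have := conjTranspose_mul_mul_le g2 T⁻¹
      simpa [e1] using this
    calc _ ≤ (T⁻¹)ᴴ * (-((κ * ρ) • 1)) * T⁻¹ := conjTranspose_mul_mul_le g3 _
      _ = -((κ * ρ) • ((T⁻¹)ᴴ * T⁻¹)) := by simp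
      _ ≤ -((κ * ρ) • (κ • 1)) :=
        neg_le_neg (smul_le_smul_of_nonneg_left e3 (by positivity))
      _ = _ := by rw [smul_smul]; congr 2; ring

end Lyapunov

/-! ### Compensating commutators -/

section Compensator

variable {ι : Type*} [Fintype ι] [DecidableEq ι]

/-- The part of a matrix `Y` commuting with `diagonal d`. -/
def blockPart (d : ι → ℝ) (Y : Matrix ι ι ℂ) : Matrix ι ι ℂ :=
  Matrix.of fun a b => if d a = d b then Y a b else 0

/-- The solution `K` of `i [K, diagonal d] = Y - blockPart d Y`. -/
def offBlockSolution (d : ι → ℝ) (Y : Matrix ι ι ℂ) : Matrix ι ι ℂ :=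
  Matrix.of fun a b => if d a = d b then 0 else Y a b / (Complex.I * (d b - d a))

omit [Fintype ι] [DecidableEq ι] in
theorem offBlockSolution_isHermitian (d : ι → ℝ) {Y : Matrix ι ι ℂ} (hY : Y.IsHermitian) :
    (offBlockSolution d Y).IsHermitian := by
  ext a b
  have h := hY.apply a b
  simp only [RCLike.star_def] at h
  by_cases hab : d a = d b
  · simp [offBlockSolution, hab]
  · have hba : ¬ d b = d a := fun h => hab h.symm
    simp only [offBlockSolution, conjTranspose_apply, of_apply, if_neg hab, if_neg hba]
    simp only [RCLike.star_def, map_div₀, map_mul, map_sub, Complex.conj_I, Complex.conj_ofReal, h]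
    congr 1
    ring

theorem offBlockSolution_comm (d : ι → ℝ) (Y : Matrix ι ι ℂ) :
    Y - Complex.I • (offBlockSolution d Y * diagonal (fun a => (d a : ℂ))
      - diagonal (fun a => (d a : ℂ)) * offBlockSolution d Y) = blockPart d Y := by
  ext a b
  simp only [Matrix.sub_apply, Matrix.smul_apply, mul_diagonal, diagonal_mul, smul_eq_mul]
  by_cases hab : d a = d b
  · simp [offBlockSolution, blockPart, hab]
  · have : (d b : ℂ) - d a ≠ 0 := by
      rw [sub_ne_zero]; exact_mod_cast Ne.symm hab
    simp only [offBlockSolution, blockPart, of_apply, if_neg hab]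
    field_simp
    ring

-- Pinching: discarding the entries between distinct eigenvalues makes the form a sum over the
-- components of `x` in the eigenspaces.
omit [DecidableEq ι] in
theorem blockPart_dotProduct (d : ι → ℝ) (Y : Matrix ι ι ℂ) (x : ι → ℂ) :
    star x ⬝ᵥ (blockPart d Y *ᵥ x) = ∑ m ∈ Finset.univ.image d,
      star (fun a => if d a = m then x a else 0) ⬝ᵥ
        (Y *ᵥ (fun a => if d a = m then x a else 0)) := by
  simp only [dotProduct, mulVec, blockPart, of_apply, Pi.star_apply, Finset.mul_sum]
  rw [Finset.sum_comm (s := Finset.univ.image d)]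
  refine Finset.sum_congr rfl fun a _ => ?_
  rw [Finset.sum_comm (s := Finset.univ.image d)]
  refine Finset.sum_congr rfl fun b _ => ?_
  rw [Finset.sum_eq_single (d a)]
  · by_cases hab : d a = d b
    · simp [hab]
    · have hba : ¬ d b = d a := fun h => hab h.symm
      simp [hab, hba]
  · intro m _ hm
    simp [hm.symm]
  · simp

/-- If the hermitian form `Y` is negative on every eigenspace of a matrix `X` that is symmetrized
by `H > 0`, then a commutator-like term makes it negative everywhere. -/
theorem exists_compensator {H X Y : Matrix ι ι ℂ} (hH : H.PosDef) (hHX : (H * X).IsHermitian)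
    (hY : Y.IsHermitian)
    (hneg : ∀ (m : ℂ) (v : ι → ℂ), X *ᵥ v = m • v → v ≠ 0 → (star v ⬝ᵥ (Y *ᵥ v)).re < 0) :
    ∃ K : Matrix ι ι ℂ, K.IsHermitian ∧
      (-(Y - Complex.I • (K * X - Xᴴ * K))).PosDef := by
  -- In the coordinates given by `H = Tᴴ * T` the matrix `X` is hermitian, hence unitarily
  -- diagonalizable with real eigenvalues `D`.
  obtain ⟨T, rfl⟩ := CStarAlgebra.nonneg_iff_eq_star_mul_self.1 hH.posSemidef.nonneg
  simp only [star_eq_conjTranspose] at hH hHX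
  have hT : IsUnit T.det := by
    have := hH.isUnit
    rw [Matrix.isUnit_iff_isUnit_det, Matrix.det_mul] at this
    exact isUnit_of_mul_isUnit_right this
  have i1 : T * T⁻¹ = 1 := Matrix.mul_nonsing_inv _ hT
  have i2 : (T⁻¹)ᴴ * Tᴴ = 1 := by rw [← conjTranspose_mul, i1, conjTranspose_one]
  have hX' : (T * X * T⁻¹).IsHermitian := by
    have : T * X * T⁻¹ = (T⁻¹)ᴴ * (Tᴴ * T * X) * T⁻¹ := by
      calc _ = ((T⁻¹)ᴴ * Tᴴ) * T * X * T⁻¹ := by rw [i2, one_mul]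
        _ = _ := by noncomm_ring
    rw [this]
    exact isHermitian_conjTranspose_mul_mul _ hHX
  obtain ⟨U, D, hU, hD⟩ : ∃ (U : Matrix ι ι ℂ) (D : ι → ℝ), Uᴴ * U = 1 ∧
      T * X * T⁻¹ * U = U * diagonal (fun a => (D a : ℂ)) := by
    refine ⟨hX'.eigenvectorUnitary, hX'.eigenvalues, ?_, ?_⟩
    · exact (Unitary.mem_iff.1 hX'.eigenvectorUnitary.2).1
    · have h1 := hX'.spectral_theorem
      have h2 := (Unitary.mem_iff.1 hX'.eigenvectorUnitary.2).1
      rw [Unitary.conjStarAlgAut_apply] at h1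
      have h3 := congrArg (· * (hX'.eigenvectorUnitary : Matrix ι ι ℂ)) h1
      refine h3.trans ?_
      rw [mul_assoc, h2, mul_one]
      rfl
  set S : Matrix ι ι ℂ := T⁻¹ * U with hS
  set V : Matrix ι ι ℂ := Uᴴ * T with hV
  have hVS : V * S = 1 := by
    calc V * S = Uᴴ * (T * T⁻¹) * U := by rw [hS, hV]; noncomm_ring
      _ = 1 := by rw [i1, mul_one, hU]
  have hSV : S * V = 1 := mul_eq_one_comm.1 hVS
  have hVS' : Sᴴ * Vᴴ = 1 := by rw [← conjTranspose_mul, hVS, conjTranspose_one]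
  have hSV' : Vᴴ * Sᴴ = 1 := by rw [← conjTranspose_mul, hSV, conjTranspose_one]
  have hXS : X * S = S * diagonal (fun a => (D a : ℂ)) := by
    calc X * S = (T⁻¹ * T) * X * S := by rw [Matrix.nonsing_inv_mul _ hT, one_mul]
      _ = T⁻¹ * (T * X * T⁻¹ * U) := by rw [hS]; noncomm_ring
      _ = _ := by rw [hD, hS, mul_assoc]
  set Δ : Matrix ι ι ℂ := diagonal (fun a => (D a : ℂ)) with hΔ
  have hΔh : Δᴴ = Δ := by
    rw [hΔ, diagonal_conjTranspose]; congr 1; ext a; simp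
  have hX1 : X = S * Δ * V := by rw [← hXS, mul_assoc, hSV, mul_one]
  have hX2 : Xᴴ = Vᴴ * Δ * Sᴴ := by
    rw [hX1]; simp only [conjTranspose_mul, hΔh, mul_assoc]
  set Y' : Matrix ι ι ℂ := Sᴴ * Y * S with hY'
  have hY'h : Y'.IsHermitian := isHermitian_conjTranspose_mul_mul _ hY
  have hYY : Y = Vᴴ * Y' * V := by
    calc Y = (Vᴴ * Sᴴ) * Y * (S * V) := by rw [hSV, hSV', one_mul, mul_one]
      _ = _ := by rw [hY']; noncomm_ring
  set K' := offBlockSolution D Y'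
  have hK' := offBlockSolution_isHermitian D hY'h
  -- As a form, `Y` transforms by congruence while `X` transforms by similarity; with `V = S⁻¹` the
  -- commutator with the diagonal matrix becomes `K * X - Xᴴ * K`.
  have key : Y - Complex.I • (Vᴴ * K' * V * X - Xᴴ * (Vᴴ * K' * V))
      = Vᴴ * blockPart D Y' * V := by
    have e1 : Vᴴ * K' * V * X = Vᴴ * (K' * Δ) * V := by
      calc _ = Vᴴ * K' * (V * S) * Δ * V := by rw [hX1]; noncomm_ring
        _ = _ := by rw [hVS]; noncomm_ring
    have e2 : Xᴴ * (Vᴴ * K' * V) = Vᴴ * (Δ * K') * V := by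
      calc _ = Vᴴ * Δ * (Sᴴ * Vᴴ) * K' * V := by rw [hX2]; noncomm_ring
        _ = _ := by rw [hVS']; noncomm_ring
    rw [e1, e2, ← offBlockSolution_comm D Y', hYY, ← hΔ]
    simp only [mul_sub, sub_mul, mul_smul_comm, smul_mul_assoc]
    rfl
  have hB : (-blockPart D Y').PosDef := by
    refine PosDef.of_dotProduct_mulVec_pos ?_ fun x hx => ?_
    · rw [← offBlockSolution_comm D Y']
      change (-_)ᴴ = _
      simp only [conjTranspose_neg, conjTranspose_sub, conjTranspose_smul, conjTranspose_mul,
        hY'h.eq, hK'.eq, ← hΔ, hΔh, RCLike.star_def, Complex.conj_I]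
      module
    · have hBh : (blockPart D Y').IsHermitian := by
        rw [← offBlockSolution_comm D Y']
        change (_)ᴴ = _
        simp only [conjTranspose_sub, conjTranspose_smul, conjTranspose_mul,
          hY'h.eq, hK'.eq, ← hΔ, hΔh, RCLike.star_def, Complex.conj_I]
        module
      have him : (star x ⬝ᵥ (blockPart D Y' *ᵥ x)).im = 0 :=
        hBh.im_star_dotProduct_mulVec_self x
      have hre : (star x ⬝ᵥ (blockPart D Y' *ᵥ x)).re < 0 := by
        rw [blockPart_dotProduct, Complex.re_sum]
        have term : ∀ m : ℝ, ∀ y : ι → ℂ, y = (fun a => if D a = m then x a else 0) → y ≠ 0 →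
            (star y ⬝ᵥ (Y' *ᵥ y)).re < 0 := by
          intro m y hy hy0
          have h1 : star y ⬝ᵥ (Y' *ᵥ y) = star (S *ᵥ y) ⬝ᵥ (Y *ᵥ (S *ᵥ y)) := by
            rw [star_mulVec, ← dotProduct_mulVec, mulVec_mulVec, mulVec_mulVec, hY', mul_assoc]
          rw [h1]
          refine hneg m _ ?_ ?_
          · rw [mulVec_mulVec, hXS, ← mulVec_mulVec, ← mulVec_smul]
            congr 1
            ext a
            rw [hΔ, mulVec_diagonal, hy]
            by_cases h : D a = m <;> simp [h]
          · intro h0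
            apply hy0
            rw [← one_mulVec y, ← hVS, ← mulVec_mulVec, h0, mulVec_zero]
        obtain ⟨a, ha⟩ := Function.ne_iff.1 hx
        refine Finset.sum_neg' (fun m _ => ?_)
          ⟨D a, Finset.mem_image_of_mem _ (Finset.mem_univ a), ?_⟩
        · by_cases h0 : (fun a => if D a = m then x a else 0) = (0 : ι → ℂ)
          · rw [h0]; simp
          · exact (term m _ rfl h0).le
        · refine term _ _ rfl fun h0 => ha ?_
          simpa using congrFun h0 a
      rw [neg_mulVec, dotProduct_neg, Complex.lt_def]
      simp [him, hre]
  refine ⟨Vᴴ * K' * V, isHermitian_conjTranspose_mul_mul _ hK', ?_⟩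
  rw [key]
  have : -(Vᴴ * blockPart D Y' * V) = Vᴴ * (-blockPart D Y') * V := by noncomm_ring
  rw [this]
  refine hB.conjTranspose_mul_mul_same ?_
  refine Function.LeftInverse.injective (g := S.mulVec) fun v => ?_
  rw [mulVec_mulVec, hSV, one_mulVec]

end Compensator

/-! ### Lyapunov's theorem for stable matrices -/

section Stable

variable {ι : Type*} [Fintype ι] [DecidableEq ι]

open scoped Matrix.Norms.L2Operator in
/-- Some power of a matrix with all eigenvalues in the open unit disc is a contraction. -/
theorem exists_norm_pow_lt_one {C : Matrix ι ι ℂ}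
    (hC : ∀ (m : ℂ) (v : ι → ℂ), v ≠ 0 → C *ᵥ v = m • v → ‖m‖ < 1) :
    ∃ k : ℕ, 0 < k ∧ ‖C ^ k‖ < 1 := by
  rcases isEmpty_or_nonempty ι with h | h
  · refine ⟨1, one_pos, ?_⟩
    rw [Subsingleton.elim (C ^ 1) 0]; simp
  have hr : spectralRadius ℂ C < (1 : NNReal) := by
    refine spectrum.spectralRadius_lt_of_forall_lt C fun m hm => ?_
    have h1 : Module.End.HasEigenvalue (Matrix.toLin' C) m := by
      rw [Module.End.hasEigenvalue_iff_mem_spectrum, Matrix.spectrum_toLin']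
      exact hm
    obtain ⟨v, hv⟩ := h1.exists_hasEigenvector
    have := hC m v hv.2 (by simpa using hv.apply_eq_smul)
    exact_mod_cast this
  -- Gelfand's formula: the `k`-th roots of `‖C ^ k‖` tend to the spectral radius, which is below
  -- one.
  have h1 := spectrum.pow_nnnorm_pow_one_div_tendsto_nhds_spectralRadius C
  have h2 := (h1.eventually_lt_const hr).and (eventually_gt_atTop 0)
  obtain ⟨k, hk, hk0⟩ := h2.exists
  refine ⟨k, hk0, ?_⟩
  by_contra hcon
  push Not at hcon
  have : (1 : ENNReal) ≤ (‖C ^ k‖₊ : ENNReal) ^ (1 / (k : ℝ)) := by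
    refine ENNReal.one_le_rpow ?_ (by positivity)
    exact_mod_cast hcon
  exact absurd hk (by simpa using this)

open scoped Matrix.Norms.L2Operator in
theorem posDef_one_sub_conjTranspose_mul_self {C : Matrix ι ι ℂ} (hC : ‖C‖ < 1) :
    (1 - Cᴴ * C).PosDef := by
  have h1 := (isHermitian_conjTranspose_mul_self C).le_norm_smul_one
  have h2 : ‖Cᴴ * C‖ = ‖C‖ * ‖C‖ := CStarRing.norm_star_mul_self
  have h3 : ‖C‖ * ‖C‖ < 1 := by nlinarith [norm_nonneg C]
  refine posDef_of_smul_one_le (c := 1 - ‖C‖ * ‖C‖) (by linarith) ?_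
  rw [h2] at h1
  rw [sub_smul, one_smul]
  exact sub_le_sub_left h1 1

/-- **Lyapunov's theorem**: a matrix with spectrum in the open left half plane is dissipative
with respect to some positive definite hermitian form. -/
theorem exists_lyapunov_of_stable {M : Matrix ι ι ℂ}
    (hM : ∀ (m : ℂ) (v : ι → ℂ), v ≠ 0 → M *ᵥ v = m • v → m.re < 0) :
    ∃ G : Matrix ι ι ℂ, G.PosDef ∧ (-(G * M + Mᴴ * G)).PosDef := by
  have hunit : IsUnit (1 - M).det := by
    rw [isUnit_iff_ne_zero]
    intro h0
    obtain ⟨v, hv, hv0⟩ := Matrix.exists_mulVec_eq_zero_iff.2 h0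
    rw [sub_mulVec, one_mulVec, sub_eq_zero] at hv0
    have := hM 1 v hv (by rw [one_smul]; exact hv0.symm)
    simp at this
    linarith
  set J := (1 - M)⁻¹ with hJ
  have j1 : (1 - M) * J = 1 := Matrix.mul_nonsing_inv _ hunit
  have j2 : J * (1 - M) = 1 := Matrix.nonsing_inv_mul _ hunit
  -- The Cayley transform carries the open left half plane to the open unit disc.
  set C := (1 + M) * J with hCdef
  have hCM : C * (1 - M) = 1 + M := by rw [hCdef, mul_assoc, j2, mul_one]
  have hC : ∀ (m : ℂ) (v : ι → ℂ), v ≠ 0 → C *ᵥ v = m • v → ‖m‖ < 1 := by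
    intro m v hv hCv
    set y := J *ᵥ v with hy
    have hvy : v = (1 - M) *ᵥ y := by rw [hy, mulVec_mulVec, j1, one_mulVec]
    have hy0 : y ≠ 0 := by
      intro h; rw [h, mulVec_zero] at hvy; exact hv hvy
    have h1 : y + M *ᵥ y = m • (y - M *ᵥ y) := by
      have : (1 + M) *ᵥ y = m • ((1 - M) *ᵥ y) := by
        rw [← hCM, ← mulVec_mulVec, ← hvy, hCv]
      simpa [add_mulVec, sub_mulVec] using this
    have hm1 : m + 1 ≠ 0 := by
      intro h
      have hm : m = -1 := by linear_combination h
      rw [hm] at h1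
      have : (2 : ℂ) • y = 0 := by
        linear_combination (norm := module) h1
      exact hy0 ((smul_eq_zero.1 this).resolve_left two_ne_zero)
    have h2 : M *ᵥ y = ((m - 1) / (m + 1)) • y := by
      have h3 : (m + 1) • M *ᵥ y = (m - 1) • y := by
        linear_combination (norm := module) h1
      rw [div_eq_inv_mul, mul_smul, ← h3, smul_smul, inv_mul_cancel₀ hm1, one_smul]
    have h3 := hM _ y hy0 h2
    have h4 : ((m - 1) / (m + 1)).re = (Complex.normSq m - 1) / Complex.normSq (m + 1) := by
      rw [Complex.div_re, ← add_div]
      congr 1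
      simp [Complex.normSq_apply]; ring
    rw [h4, div_neg_iff] at h3
    have h5 := Complex.normSq_pos.2 hm1
    have h6 : Complex.normSq m < 1 := by
      rcases h3 with h3 | h3
      · linarith [h3.2]
      · linarith [h3.1]
    rw [Complex.normSq_eq_norm_sq] at h6
    nlinarith [norm_nonneg m]
  obtain ⟨k, hk0, hk⟩ := exists_norm_pow_lt_one hC
  -- A truncated discrete Lyapunov series: `G - Cᴴ * G * C` telescopes to `1 - (C ^ k)ᴴ * C ^ k`,
  -- positive since `C ^ k` is a contraction.
  set G := ∑ i ∈ Finset.range k, (C ^ i)ᴴ * C ^ i with hG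
  have hGpos : G.PosDef := by
    obtain ⟨j, rfl⟩ := Nat.exists_eq_succ_of_ne_zero hk0.ne'
    rw [hG, Finset.sum_range_succ']
    refine PosDef.posSemidef_add (posSemidef_sum _ fun i _ =>
      posSemidef_conjTranspose_mul_self _) ?_
    simpa using PosDef.one
  have htel : G - Cᴴ * G * C = 1 - (C ^ k)ᴴ * C ^ k := by
    have h1 : Cᴴ * G * C = ∑ i ∈ Finset.range k, (C ^ (i + 1))ᴴ * C ^ (i + 1) := by
      rw [hG, Finset.mul_sum, Finset.sum_mul]
      refine Finset.sum_congr rfl fun i _ => ?_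
      rw [pow_succ, conjTranspose_mul (C ^ i) C]
      noncomm_ring
    rw [h1, hG, ← Finset.sum_sub_distrib, Finset.sum_range_sub'
      (fun i => (C ^ i)ᴴ * C ^ i) k]
    simp
  refine ⟨G, hGpos, ?_⟩
  have h1 : -(G * M + Mᴴ * G) = (1 / 2 : ℂ) • ((1 - M)ᴴ * (G - Cᴴ * G * C) * (1 - M)) := by
    have h2 : (1 - M)ᴴ * Cᴴ = (1 + M)ᴴ := by rw [← conjTranspose_mul, hCM]
    have h3 : (1 - M)ᴴ * (G - Cᴴ * G * C) * (1 - M)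
        = (1 - M)ᴴ * G * (1 - M) - (1 + M)ᴴ * G * (1 + M) := by
      rw [← h2, ← hCM]
      noncomm_ring
    rw [h3]
    simp only [conjTranspose_add, conjTranspose_sub, conjTranspose_one, mul_add, add_mul, mul_sub,
      sub_mul, one_mul, mul_one]
    module
  rw [h1, htel]
  refine PosDef.smul ?_ (by norm_num)
  refine (posDef_one_sub_conjTranspose_mul_self hk).conjTranspose_mul_mul_same ?_
  refine Function.LeftInverse.injective (g := J.mulVec) fun v => ?_
  rw [mulVec_mulVec, j2, one_mulVec]

end Stable

/-! ### Positive definite block matrices -/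

section Blocks

variable {ι : Type*} [Fintype ι] [DecidableEq ι]

theorem exists_le_smul_one {N : Matrix ι ι ℂ} (hN : N.IsHermitian) :
    ∃ c : ℝ, 0 < c ∧ N ≤ c • (1 : Matrix ι ι ℂ) := by
  obtain ⟨c, hc, h⟩ := eventually_le_smul_one (l := pure ()) (N := fun _ => N)
    tendsto_const_nhds (by simpa using hN)
  exact ⟨c, hc, by simpa using h⟩

omit [DecidableEq ι] in
theorem Matrix.PosDef.fromBlocks_zero {A D : Matrix ι ι ℂ} (hA : A.PosDef) (hD : D.PosDef) :
    (fromBlocks A 0 0 D).PosDef := by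
  refine PosDef.of_dotProduct_mulVec_pos ?_ fun x hx => ?_
  · exact hA.isHermitian.fromBlocks (by simp) hD.isHermitian
  · obtain ⟨u, v, rfl⟩ : ∃ u v, x = Sum.elim u v :=
      ⟨x ∘ Sum.inl, x ∘ Sum.inr, (Sum.elim_comp_inl_inr x).symm⟩
    have e : star (Sum.elim u v) ⬝ᵥ (fromBlocks A 0 0 D *ᵥ Sum.elim u v)
        = star u ⬝ᵥ (A *ᵥ u) + star v ⬝ᵥ (D *ᵥ v) := by
      rw [fromBlocks_mulVec]
      simp [dotProduct, Fintype.sum_sum_type]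
    rw [e]
    by_cases hu : u = 0
    · have hv : v ≠ 0 := by
        rintro rfl
        apply hx
        rw [hu]; ext i; cases i <;> rfl
      exact add_pos_of_nonneg_of_pos (hA.posSemidef.dotProduct_mulVec_nonneg u)
        (hD.dotProduct_mulVec_pos hv)
    · exact add_pos_of_pos_of_nonneg (hA.dotProduct_mulVec_pos hu)
        (hD.posSemidef.dotProduct_mulVec_nonneg v)

/-- A block matrix with positive definite diagonal blocks becomes positive definite once its lower
right block is scaled up. -/
theorem exists_posDef_fromBlocks_smul {N S : Matrix ι ι ℂ} (hN : N.PosDef) (hS : S.PosDef)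
    (X : Matrix ι ι ℂ) :
    ∃ b : ℝ, 0 < b ∧ (fromBlocks N X Xᴴ ((b : ℂ) • S)).PosDef := by
  obtain ⟨c, hc, hcS⟩ := hS.exists_smul_one_le
  have hi1 : N * N⁻¹ = 1 := Matrix.mul_nonsing_inv _ ((Matrix.isUnit_iff_isUnit_det _).1 hN.isUnit)
  have hi2 : N⁻¹ * N = 1 := Matrix.nonsing_inv_mul _ ((Matrix.isUnit_iff_isUnit_det _).1 hN.isUnit)
  have hih : N⁻¹ᴴ = N⁻¹ := hN.inv.isHermitian
  have hZ : (Xᴴ * N⁻¹ * X).IsHermitian := isHermitian_conjTranspose_mul_mul _ hN.inv.isHermitian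
  obtain ⟨C, hC, hCZ⟩ := exists_le_smul_one hZ
  refine ⟨(C + 1) / c, by positivity, ?_⟩
  have hD : ((((C + 1) / c : ℝ) : ℂ) • S - Xᴴ * N⁻¹ * X).PosDef := by
    refine posDef_of_smul_one_le one_pos ?_
    calc (1 : ℝ) • (1 : Matrix ι ι ℂ) = ((C + 1) / c) • c • 1 - C • 1 := by
          rw [smul_smul, div_mul_cancel₀ _ hc.ne']; module
      _ ≤ ((C + 1) / c) • S - Xᴴ * N⁻¹ * X :=
          sub_le_sub (smul_le_smul_of_nonneg_left hcS (by positivity)) hCZ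
      _ = _ := by rw [Complex.coe_smul]
  -- Block elimination; the last diagonal entry is the Schur complement, at least 1 by the choice of
  -- the scaling factor.
  have e : fromBlocks N X Xᴴ ((((C + 1) / c : ℝ) : ℂ) • S) = (fromBlocks 1 (N⁻¹ * X) 0 1)ᴴ *
      fromBlocks N 0 0 ((((C + 1) / c : ℝ) : ℂ) • S - Xᴴ * N⁻¹ * X) *
      fromBlocks 1 (N⁻¹ * X) 0 1 := by
    simp only [fromBlocks_conjTranspose, fromBlocks_multiply, conjTranspose_one,
      conjTranspose_zero, conjTranspose_mul, hih, zero_mul, mul_zero, add_zero, zero_add, one_mul,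
      mul_one]
    congr 1
    · rw [← mul_assoc, hi1, one_mul]
    · rw [mul_assoc, hi2, mul_one]
    · rw [mul_assoc Xᴴ, hi2, mul_one, mul_assoc]; abel
  rw [e]
  refine (hN.fromBlocks_zero hD).conjTranspose_mul_mul_same ?_
  refine Function.LeftInverse.injective
    (g := (fromBlocks 1 (-(N⁻¹ * X)) 0 1 : Matrix (ι ⊕ ι) (ι ⊕ ι) ℂ).mulVec) fun v => ?_
  rw [mulVec_mulVec, fromBlocks_multiply]
  simp

/-- A Gram factorization with nonzero determinant remains one over ℂ, so real test vectors suffice.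
-/
theorem posDef_toCMat {S : Matrix ι ι ℝ} (hS : S.PosDef) : (toCMat S).PosDef := by
  obtain ⟨T, rfl⟩ := CStarAlgebra.nonneg_iff_eq_star_mul_self.1 hS.posSemidef.nonneg
  have e : toCMat (star T * T) = (toCMat T)ᴴ * toCMat T := by
    ext i j
    simp [toCMat, Matrix.mul_apply]
  have hu := hS.isUnit
  rw [Matrix.isUnit_iff_isUnit_det, isUnit_iff_ne_zero] at hu
  have hd : (toCMat (star T * T)).det ≠ 0 := by
    have := RingHom.map_det Complex.ofRealHom (star T * T)
    intro h
    apply hu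
    rw [← Complex.ofReal_eq_zero]
    exact this.trans h
  rw [e] at hd ⊢
  exact ((posSemidef_conjTranspose_mul_self _).posDef_iff_det_ne_zero).2 hd

end Blocks

/-! ### Separation of slow and fast modes at low frequency -/

section LowFrequency

variable {ι X : Type*} [Fintype ι] [DecidableEq ι]

/-- The map whose multiple by `r` parametrizes the slow invariant subspace to second order. -/
def slowMap (W V : Matrix ι ι ℂ) (r : ℂ) : Matrix ι ι ℂ := -(Complex.I • W) + r • V

/-- The defect of invariance of the approximate slow subspace, divided by `r ^ 3`. -/
def slowDefect (C W V : Matrix ι ι ℂ) (r : ℂ) : Matrix ι ι ℂ :=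
  Complex.I • (C * V) + Complex.I • (W * V + V * W) - r • (V * V)

/-- The residual coupling of the fast variable into the slow one, divided by `r`. -/
def slowCoupling (J C W V : Matrix ι ι ℂ) (r : ℂ) : Matrix ι ι ℂ :=
  -(slowMap W V r * J) + J * (Complex.I • C - slowMap W V r)
    - r ^ 2 • (J * slowDefect C W V r * J)

/-- The change of variables to slow and fast variables. -/
def slowFast (J W V : Matrix ι ι ℂ) (r : ℂ) : Matrix (ι ⊕ ι) (ι ⊕ ι) ℂ :=
  fromBlocks (1 - r • (J * slowMap W V r)) J (-(r • slowMap W V r)) 1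

/-- The symbol in slow and fast variables. -/
def slowFastSymbol (A₀ J C W V : Matrix ι ι ℂ) (r : ℂ) : Matrix (ι ⊕ ι) (ι ⊕ ι) ℂ :=
  fromBlocks (r • slowMap W V r + r ^ 3 • (J * slowDefect C W V r))
    (r • slowCoupling J C W V r) (r ^ 3 • slowDefect C W V r)
    (r • (Complex.I • C) - A₀ - r • slowMap W V r - r ^ 3 • (slowDefect C W V r * J))

/-- The energy production, rescaled by `diag(r, 1)` on both sides. -/
def slowFastProduction (A₀ J S K C W V H : Matrix ι ι ℂ) (r : ℂ) : Matrix (ι ⊕ ι) (ι ⊕ ι) ℂ :=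
  fromBlocks
    (H * V - Complex.I • (K * W) + r • (K * V + (H + r • K) * J * slowDefect C W V r))
    ((H + r • K) * slowCoupling J C W V r) (r ^ 2 • (S * slowDefect C W V r))
    (S * (-A₀ + r • (Complex.I • C - slowMap W V r - r ^ 2 • (slowDefect C W V r * J))))

/-- This is the Riccati equation for invariance of the graph of `r • slowMap W V r`. With B written
as CW + W² - A⁰V, its terms of orders `r` and `r ^ 2` cancel. -/
theorem slowMap_defect (A₀ C W V : Matrix ι ι ℂ) (r : ℂ) :
    -(r • (Complex.I • (A₀ * W))) - r ^ 2 • (C * W + W * W - A₀ * V)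
      + (r • (Complex.I • C) - A₀) * (r • slowMap W V r)
      - (r • slowMap W V r) * (r • slowMap W V r) = r ^ 3 • slowDefect C W V r := by
  simp only [slowMap, slowDefect, mul_add, add_mul, sub_mul, smul_mul_assoc,
    mul_smul_comm, mul_neg, neg_mul, smul_add, smul_sub, smul_neg, smul_smul]
  match_scalars <;> ring_nf <;> simp only [Complex.I_sq] <;> ring

/-- The fast variable is z = u_t - rΦu with Φ the slow map, and the slow one is u + Jz. Since z
decays like -A⁰z to leading order, adding Jz cancels the order-one feed of z into u_t, leaving a
coupling of order `r`. -/
theorem slowFast_intertwines {A₀ J : Matrix ι ι ℂ} (hJ : J * A₀ = 1) (C W V : Matrix ι ι ℂ)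
    (r : ℂ) :
    slowFast J W V r * fromBlocks 0 1
        (-(r • (Complex.I • (A₀ * W))) - r ^ 2 • (C * W + W * W - A₀ * V))
        (r • (Complex.I • C) - A₀)
      = slowFastSymbol A₀ J C W V r * slowFast J W V r := by
  have hR := slowMap_defect A₀ C W V r
  set L := -(r • (Complex.I • (A₀ * W))) - r ^ 2 • (C * W + W * W - A₀ * V)
  have hQ : r • slowCoupling J C W V r = 1 - (r • slowMap W V r) * J
      + J * ((r • (Complex.I • C) - A₀) - r • slowMap W V r)
      - J * (r ^ 3 • slowDefect C W V r) * J := by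
    rw [show (1 : Matrix ι ι ℂ) = J * A₀ from hJ.symm]
    simp only [slowCoupling, mul_sub, smul_mul_assoc,
      mul_smul_comm, smul_add, smul_sub, smul_neg, smul_smul]
    module
  simp only [slowFast, slowFastSymbol, fromBlocks_multiply, hQ]
  rw [← mul_smul_comm (r ^ 3) J, ← smul_mul_assoc (r ^ 3) _ J, ← mul_smul_comm r J]
  generalize r • slowMap W V r = Φ at *
  generalize r • (Complex.I • C) - A₀ = Q at *
  rw [← hR]
  congr 1 <;> noncomm_ring

/-- The only term of order `r` in the slow block is `-i r H W`, skew-hermitian once `H * W` is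
hermitian. All other terms carry enough powers of `r` to factor out `diag(r, 1)` on both sides. -/
theorem slowFast_energy (A₀ J S K C W V H : Matrix ι ι ℂ) (r : ℂ) :
    fromBlocks (H + r • K) 0 0 S * slowFastSymbol A₀ J C W V r
      = fromBlocks (r • 1) 0 0 1 * slowFastProduction A₀ J S K C W V H r * fromBlocks (r • 1) 0 0 1
        + fromBlocks (-(Complex.I • (r • (H * W)))) 0 0 0 := by
  simp only [slowFastSymbol, slowFastProduction, fromBlocks_multiply, fromBlocks_add]
  congr 1
  · simp only [slowMap, mul_add, add_mul, mul_sub, smul_mul_assoc, mul_assoc, zero_mul,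
      mul_zero, mul_one, one_mul,
      mul_smul_comm, mul_neg, smul_add, smul_sub, smul_neg, smul_smul]
    module
  · simp
  · simp only [mul_smul_comm, zero_mul, mul_zero, mul_one, one_mul]
    module
  · simp only [mul_add, add_mul, mul_sub, smul_mul_assoc, mul_assoc, zero_mul,
      mul_zero, mul_one, one_mul,
      mul_smul_comm, mul_neg, smul_add, smul_sub, smul_smul]
    module

theorem slowFast_lyapunov_identity {A₀ J S K C W V H : Matrix ι ι ℂ} (hJ : J * A₀ = 1)
    (hH : H.IsHermitian) (hK : K.IsHermitian) (hS : S.IsHermitian) (hHW : (H * W).IsHermitian)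
    (r : ℝ) {M G F : Matrix (ι ⊕ ι) (ι ⊕ ι) ℂ}
    (hM : M = fromBlocks 0 1
        (-((r : ℂ) • (Complex.I • (A₀ * W))) - (r : ℂ) ^ 2 • (C * W + W * W - A₀ * V))
        ((r : ℂ) • (Complex.I • C) - A₀))
    (hG : G = (slowFast J W V r)ᴴ * fromBlocks (H + (r : ℂ) • K) 0 0 S * slowFast J W V r)
    (hF : F = fromBlocks ((r : ℂ) • 1) 0 0 1 * slowFast J W V r) :
    G * M + Mᴴ * G = -(Fᴴ * (-(slowFastProduction A₀ J S K C W V H r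
      + (slowFastProduction A₀ J S K C W V H r)ᴴ)) * F) := by
  have h1 := slowFast_intertwines hJ C W V r
  rw [← hM] at h1
  have h2 := slowFast_energy A₀ J S K C W V H r
  have hG₀ : (fromBlocks (H + (r : ℂ) • K) 0 0 S)ᴴ = fromBlocks (H + (r : ℂ) • K) 0 0 S := by
    simp [fromBlocks_conjTranspose, hH.eq, hK.eq, hS.eq]
  have hD : (fromBlocks ((r : ℂ) • 1) 0 0 1 : Matrix (ι ⊕ ι) (ι ⊕ ι) ℂ)ᴴ
      = fromBlocks ((r : ℂ) • 1) 0 0 1 := by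
    simp [fromBlocks_conjTranspose]
  have hskew : (fromBlocks (-(Complex.I • ((r : ℂ) • (H * W)))) 0 0 0 :
      Matrix (ι ⊕ ι) (ι ⊕ ι) ℂ)ᴴ
      = -fromBlocks (-(Complex.I • ((r : ℂ) • (H * W)))) 0 0 0 := by
    rw [fromBlocks_conjTranspose, fromBlocks_neg]
    congr 1
    · rw [conjTranspose_neg, conjTranspose_smul, conjTranspose_smul, hHW.eq]
      simp
    all_goals simp
  set D : Matrix (ι ⊕ ι) (ι ⊕ ι) ℂ := fromBlocks ((r : ℂ) • 1) 0 0 1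
  set Θ := slowFast J W V r
  set N := slowFastSymbol A₀ J C W V r
  set E := slowFastProduction A₀ J S K C W V H r
  set G₀ : Matrix (ι ⊕ ι) (ι ⊕ ι) ℂ := fromBlocks (H + (r : ℂ) • K) 0 0 S
  set Z : Matrix (ι ⊕ ι) (ι ⊕ ι) ℂ := fromBlocks (-(Complex.I • ((r : ℂ) • (H * W)))) 0 0 0
  have h3 : Nᴴ * G₀ = D * Eᴴ * D - Z := by
    have := congrArg conjTranspose h2
    simp only [conjTranspose_mul, conjTranspose_add, hG₀, hD, hskew] at this
    rw [this]; noncomm_ring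
  have h4 : Mᴴ * Θᴴ = Θᴴ * Nᴴ := by
    have := congrArg conjTranspose h1
    simpa only [conjTranspose_mul] using this
  calc G * M + Mᴴ * G = Θᴴ * G₀ * (Θ * M) + (Mᴴ * Θᴴ) * G₀ * Θ := by rw [hG]; noncomm_ring
    _ = Θᴴ * (G₀ * N) * Θ + Θᴴ * (Nᴴ * G₀) * Θ := by rw [h1, h4]; noncomm_ring
    _ = _ := by
      rw [h2, h3, hF, conjTranspose_mul, hD]; noncomm_ring

theorem continuous_slowFast (J : Matrix ι ι ℂ) :
    Continuous fun p : Matrix ι ι ℂ × Matrix ι ι ℂ × ℂ => slowFast J p.1 p.2.1 p.2.2 := by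
  unfold slowFast slowMap
  fun_prop

omit [DecidableEq ι] in
theorem continuous_slowFastProduction (A₀ J S K : Matrix ι ι ℂ) :
    Continuous fun p : Matrix ι ι ℂ × Matrix ι ι ℂ × Matrix ι ι ℂ × Matrix ι ι ℂ × ℂ =>
      slowFastProduction A₀ J S K p.1 p.2.1 p.2.2.1 p.2.2.2.1 p.2.2.2.2 := by
  unfold slowFastProduction slowCoupling slowDefect slowMap
  fun_prop

theorem tendsto_slowFast {l : Filter X} {W V : X → Matrix ι ι ℂ} {r : X → ℂ}
    {W₀ V₀ : Matrix ι ι ℂ} {r₀ : ℂ} (J : Matrix ι ι ℂ) (hW : Tendsto W l (𝓝 W₀))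
    (hV : Tendsto V l (𝓝 V₀)) (hr : Tendsto r l (𝓝 r₀)) :
    Tendsto (fun x => slowFast J (W x) (V x) (r x)) l (𝓝 (slowFast J W₀ V₀ r₀)) := by
  have h := ((continuous_slowFast J).tendsto (W₀, V₀, r₀)).comp
    (hW.prodMk_nhds (hV.prodMk_nhds hr))
  simp only [Function.comp_def] at h
  exact h

omit [DecidableEq ι] in
theorem tendsto_slowFastProduction {l : Filter X} {C W V H : X → Matrix ι ι ℂ} {r : X → ℂ}
    {C₀ W₀ V₀ H₀ : Matrix ι ι ℂ} {r₀ : ℂ} (A₀ J S K : Matrix ι ι ℂ) (hC : Tendsto C l (𝓝 C₀))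
    (hW : Tendsto W l (𝓝 W₀)) (hV : Tendsto V l (𝓝 V₀)) (hH : Tendsto H l (𝓝 H₀))
    (hr : Tendsto r l (𝓝 r₀)) :
    Tendsto (fun x => slowFastProduction A₀ J S K (C x) (W x) (V x) (H x) (r x)) l
      (𝓝 (slowFastProduction A₀ J S K C₀ W₀ V₀ H₀ r₀)) := by
  have h := (continuous_slowFastProduction A₀ J S K).tendsto (C₀, W₀, V₀, H₀, r₀)
  have h' := h.comp (hC.prodMk_nhds (hW.prodMk_nhds (hV.prodMk_nhds (hH.prodMk_nhds hr))))
  simp only [Function.comp_def] at h'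
  exact h'

/-- The change of variables is a product of two block unipotent matrices, hence invertible for every
`r`, including the limit `r = 0`. -/
theorem slowFast_injective (J W V : Matrix ι ι ℂ) (r : ℂ) :
    Function.Injective (slowFast J W V r).mulVec := by
  refine Function.LeftInverse.injective (g := (fromBlocks 1 (-J) (r • slowMap W V r)
    (1 - r • (slowMap W V r * J)) : Matrix (ι ⊕ ι) (ι ⊕ ι) ℂ).mulVec) fun v => ?_
  have : (fromBlocks 1 (-J) (r • slowMap W V r)
    (1 - r • (slowMap W V r * J)) : Matrix (ι ⊕ ι) (ι ⊕ ι) ℂ) * slowFast J W V r = 1 := by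
    rw [slowFast, fromBlocks_multiply, ← fromBlocks_one, ← mul_smul_comm r J,
      ← smul_mul_assoc r _ J]
    generalize r • slowMap W V r = Φ
    congr 1 <;> noncomm_ring
  rw [mulVec_mulVec, this, one_mulVec]

end LowFrequency

/-! ### Lyapunov matrices in the three frequency regimes -/

section FrequencyRegimes

variable {ι : Type} {X : Type*} [Fintype ι] [DecidableEq ι]

theorem HasLyapunov.mono_rate {κ ρ ρ' : ℝ} {M : Matrix ι ι ℂ} (h : HasLyapunov κ ρ M)
    (hκ : 0 ≤ κ) (hρ : ρ' ≤ ρ) : HasLyapunov κ ρ' M := by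
  obtain ⟨G, h1, h2, h3⟩ := h
  exact ⟨G, h1, h2, h3.trans (neg_le_neg (smul_le_smul_of_nonneg_right
      (mul_le_mul_of_nonneg_left hρ hκ) zero_le_one))⟩

/-- The Lyapunov matrix of the limit, kept constant, serves all nearby matrices. -/
theorem eventually_hasLyapunov_of_stable {l : Filter X} {M : X → Matrix ι ι ℂ}
    {M₀ : Matrix ι ι ℂ} (hM : Tendsto M l (𝓝 M₀))
    (hM₀ : ∀ (m : ℂ) (v : ι → ℂ), v ≠ 0 → M₀ *ᵥ v = m • v → m.re < 0) :
    ∃ κ : ℝ, 0 < κ ∧ ∀ᶠ x in l, HasLyapunov κ 1 (M x) := by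
  obtain ⟨G, hG, hGM⟩ := exists_lyapunov_of_stable hM₀
  have hc : Continuous fun M : Matrix ι ι ℂ => -(G * M + Mᴴ * G) := by fun_prop
  refine eventually_hasLyapunov (l := l) (ρ := fun _ => 1) (G := fun _ => G)
    (N := fun x => -(G * M x + (M x)ᴴ * G)) (F := fun _ => 1)
    (fun _ => zero_le_one) tendsto_const_nhds hG (Eventually.of_forall fun _ => hG.isHermitian)
    ((hc.tendsto M₀).comp hM) hGM (Eventually.of_forall fun x => ?_)
    ⟨1, one_pos, Eventually.of_forall fun x => by simp⟩ (Eventually.of_forall fun x => by simp)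
  change (_)ᴴ = _
  simp [hG.isHermitian.eq, add_comm]

theorem NegOnEigenspaces.lt_zero {W₀ W₁ : Matrix ι ι ℂ} {c : ℝ} (h : NegOnEigenspaces W₀ W₁ c)
    (hc : 0 < c) {m : ℂ} {v : ι → ℂ} (hv : W₀ *ᵥ v = m • v) (hv0 : v ≠ 0) :
    (star v ⬝ᵥ ((W₁ + W₁ᴴ) *ᵥ v)).re < 0 := by
  have h1 := h m v hv
  have h2 : (0 : ℂ) < star v ⬝ᵥ v := dotProduct_star_self_pos_iff.2 hv0
  have h3 : 0 < (star v ⬝ᵥ v).re := (Complex.lt_def.1 h2).1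
  nlinarith

/-- With energy `H + s K`, the singular term `s⁻¹ H B` is skew-hermitian and drops out; the product
of `s K` with `s⁻¹ B` leaves the compensating term `K B` of order one. -/
theorem eventually_hasLyapunov_high {l : Filter X} {s : X → ℝ} {H B A : X → Matrix ι ι ℂ}
    {H₀ B₀ A₀ : Matrix ι ι ℂ} (hs : Tendsto s l (𝓝 0)) (hs0 : ∀ᶠ x in l, 0 < s x)
    (hH : Tendsto H l (𝓝 H₀)) (hB : Tendsto B l (𝓝 B₀)) (hA : Tendsto A l (𝓝 A₀))
    (hH₀ : H₀.PosDef) (hHh : ∀ᶠ x in l, (H x).IsHermitian)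
    (hHB₀ : (H₀ * (Complex.I • B₀)).IsHermitian)
    (hHB : ∀ᶠ x in l, (H x * (Complex.I • B x)).IsHermitian)
    {c : ℝ} (hc : 0 < c) (hneg : NegOnEigenspaces B₀ (H₀ * A₀) c) :
    ∃ κ : ℝ, 0 < κ ∧ ∀ᶠ x in l, HasLyapunov κ 1 (((s x)⁻¹ : ℂ) • B x + A x) := by
  have hYh : (H₀ * A₀ + (H₀ * A₀)ᴴ).IsHermitian := by
    change (_)ᴴ = _
    simp [add_comm]
  -- The compensator is applied to `I • B₀`, the matrix that is symmetrized; an eigenvalue `m` of it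
  -- is the eigenvalue `-I * m` of `B₀`.
  obtain ⟨K, hK, hKpos⟩ := exists_compensator hH₀ hHB₀ hYh fun m v hv hv0 => by
    refine hneg.lt_zero hc (m := -Complex.I * m) ?_ hv0
    rw [mul_smul, ← hv, smul_mulVec, smul_smul]
    simp
  let f : Matrix ι ι ℂ × Matrix ι ι ℂ × Matrix ι ι ℂ × ℂ → Matrix ι ι ℂ := fun p =>
    -(p.1 * p.2.2.1 + K * p.2.1 + p.2.2.2 • (K * p.2.2.1)
      + (p.1 * p.2.2.1 + K * p.2.1 + p.2.2.2 • (K * p.2.2.1))ᴴ)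
  have hf : Continuous f := by fun_prop
  have hg : Continuous fun p : Matrix ι ι ℂ × ℂ => p.1 + p.2 • K := by fun_prop
  have hsC : Tendsto (fun x => (s x : ℂ)) l (𝓝 0) := by
    have := (Complex.continuous_ofReal.tendsto 0).comp hs
    simpa [Function.comp_def] using this
  refine eventually_hasLyapunov (ρ := fun _ => 1) (fun _ => zero_le_one)
    (G := fun x => H x + (s x : ℂ) • K) (N := fun x => f (H x, B x, A x, s x))
    (F := fun _ => 1) ((hg.tendsto (H₀, 0)).comp (hH.prodMk_nhds hsC)) (by simpa using hH₀) ?_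
    ((hf.tendsto (H₀, B₀, A₀, 0)).comp (hH.prodMk_nhds (hB.prodMk_nhds (hA.prodMk_nhds hsC))))
    ?_ ?_ ⟨1, one_pos, Eventually.of_forall fun x => by simp⟩ ?_
  · filter_upwards [hHh] with x hx
    change (_)ᴴ = _
    simp [hx.eq, hK.eq]
  · convert hKpos using 1
    simp only [f, zero_smul, add_zero, conjTranspose_add, conjTranspose_smul, conjTranspose_mul,
      hK.eq, RCLike.star_def, Complex.conj_I, mul_smul_comm, smul_mul_assoc, smul_sub, smul_smul,
      mul_neg, Complex.I_mul_I, map_zero]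
    module
  · refine Eventually.of_forall fun x => ?_
    change (_)ᴴ = _
    simp only [f, conjTranspose_neg, conjTranspose_add, conjTranspose_conjTranspose]
    abel
  · filter_upwards [hs0, hHh, hHB] with x hx hxh hxB
    have hx' : (s x : ℂ) ≠ 0 := by exact_mod_cast hx.ne'
    have h1 : (B x)ᴴ * H x = -(H x * B x) := by
      have := hxB.eq
      simp only [conjTranspose_mul, conjTranspose_smul, hxh.eq, RCLike.star_def, Complex.conj_I,
        mul_smul_comm] at this
      have h2 := congrArg (Complex.I • ·) this
      simp only [smul_smul] at h2
      simpa [neg_eq_iff_eq_neg] using h2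
    simp only [f, one_mul, mul_one, conjTranspose_one, conjTranspose_add, conjTranspose_smul,
      conjTranspose_mul, hxh.eq, hK.eq, add_mul, mul_add, smul_mul_assoc, mul_smul_comm, h1,
      RCLike.star_def, map_inv₀, Complex.conj_ofReal]
    match_scalars <;> field_simp <;> ring

theorem eventually_hasLyapunov_low {l : Filter X} {r : X → ℝ} {C W V H : X → Matrix ι ι ℂ}
    {A₀ J S C₀ W₀ V₀ H₀ : Matrix ι ι ℂ} (hJ : J * A₀ = 1) (hS : S.PosDef)
    (hSA : (S * A₀).PosDef) (hr : Tendsto r l (𝓝 0))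
    (hC : Tendsto C l (𝓝 C₀)) (hW : Tendsto W l (𝓝 W₀)) (hV : Tendsto V l (𝓝 V₀))
    (hH : Tendsto H l (𝓝 H₀)) (hH₀ : H₀.PosDef) (hHh : ∀ᶠ x in l, (H x).IsHermitian)
    (hHW₀ : (H₀ * W₀).IsHermitian) (hHW : ∀ᶠ x in l, (H x * W x).IsHermitian)
    {c : ℝ} (hc : 0 < c) (hneg : NegOnEigenspaces W₀ (H₀ * V₀) c) :
    ∃ κ : ℝ, 0 < κ ∧ ∀ᶠ x in l, HasLyapunov κ (r x ^ 2) (fromBlocks 0 1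
        (-((r x : ℂ) • (Complex.I • (A₀ * W x)))
          - (r x : ℂ) ^ 2 • (C x * W x + W x * W x - A₀ * V x))
        ((r x : ℂ) • (Complex.I • C x) - A₀)) := by
  have hYh : (H₀ * V₀ + (H₀ * V₀)ᴴ).IsHermitian := by
    change (_)ᴴ = _
    simp [add_comm]
  obtain ⟨K, hK, hKpos⟩ := exists_compensator hH₀ hHW₀ hYh fun _ _ => hneg.lt_zero hc
  set X₀ := -(H₀ * slowCoupling J C₀ W₀ V₀ 0) with hX₀
  -- The coupling `X₀` does not involve the fast weight, so weighting the fast energy by a large `b`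
  -- dominates it. The factor 2 comes from adding `S * A₀` to its adjoint.
  obtain ⟨b, hb, hbpos⟩ := exists_posDef_fromBlocks_smul hKpos
    (hSA.smul (by norm_num : (0 : ℂ) < 2)) X₀
  have hbC : (0 : ℂ) < b := by exact_mod_cast hb
  have hbS : ((b : ℂ) • S).PosDef := hS.smul hbC
  have hrC : Tendsto (fun x => (r x : ℂ)) l (𝓝 0) := by
    have := (Complex.continuous_ofReal.tendsto 0).comp hr
    simpa [Function.comp_def] using this
  have hΘ := tendsto_slowFast J hW hV hrC
  have hE := tendsto_slowFastProduction A₀ J ((b : ℂ) • S) K hC hW hV hH hrC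
  have hE₀ : (-(slowFastProduction A₀ J ((b : ℂ) • S) K C₀ W₀ V₀ H₀ 0
      + (slowFastProduction A₀ J ((b : ℂ) • S) K C₀ W₀ V₀ H₀ 0)ᴴ)).PosDef := by
    convert hbpos using 1
    have hSAh : A₀ᴴ * S = S * A₀ := by
      have := hSA.isHermitian.eq
      rwa [conjTranspose_mul, hS.isHermitian.eq] at this
    rw [slowFastProduction, fromBlocks_conjTranspose, fromBlocks_add, fromBlocks_neg]
    congr 1
    · simp only [zero_smul, add_zero, conjTranspose_sub, conjTranspose_smul, conjTranspose_mul,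
        hK.eq, RCLike.star_def, Complex.conj_I]
      module
    · simp [hX₀]
    · simp [hX₀]
    · simp [hSAh, hS.isHermitian.eq]
      module
  have hG₀ : ((slowFast J W₀ V₀ 0)ᴴ * fromBlocks (H₀ + (0 : ℂ) • K) 0 0 ((b : ℂ) • S)
      * slowFast J W₀ V₀ 0).PosDef := by
    refine PosDef.conjTranspose_mul_mul_same ?_ (slowFast_injective _ _ _ _)
    rw [zero_smul, add_zero]
    exact hH₀.fromBlocks_zero hbS
  have hcG : Continuous fun p : Matrix (ι ⊕ ι) (ι ⊕ ι) ℂ × Matrix ι ι ℂ × ℂ =>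
      p.1ᴴ * fromBlocks (p.2.1 + p.2.2 • K) 0 0 ((b : ℂ) • S) * p.1 := by fun_prop
  have hG := (hcG.tendsto (_, H₀, 0)).comp (hΘ.prodMk_nhds (hH.prodMk_nhds hrC))
  have hN := ((continuous_id.add continuous_id.matrix_conjTranspose).neg.tendsto _).comp hE
  simp only [Function.comp_def, id] at hG hN
  refine eventually_hasLyapunov (ρ := fun x => r x ^ 2) (fun _ => sq_nonneg _)
    (G := fun x => (slowFast J (W x) (V x) (r x))ᴴ *
      fromBlocks (H x + (r x : ℂ) • K) 0 0 ((b : ℂ) • S) * slowFast J (W x) (V x) (r x))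
    (F := fun x => fromBlocks ((r x : ℂ) • 1) 0 0 1 * slowFast J (W x) (V x) (r x))
    hG hG₀ ?_
    hN hE₀ ?_ ?_ ?_
  · filter_upwards [hHh] with x hx
    refine isHermitian_conjTranspose_mul_mul _ ?_
    refine IsHermitian.fromBlocks ?_ (by simp) hbS.isHermitian
    change (_)ᴴ = _
    simp [hx.eq, hK.eq]
  · refine Eventually.of_forall fun x => ?_
    change (_)ᴴ = _
    simp [add_comm]
  · have hpos : ((slowFast J W₀ V₀ 0)ᴴ * slowFast J W₀ V₀ 0).PosDef :=
      PosDef.conjTranspose_mul_self _ (slowFast_injective _ _ _ _)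
    have hc2 : Continuous fun p : Matrix (ι ⊕ ι) (ι ⊕ ι) ℂ => pᴴ * p := by fun_prop
    obtain ⟨a, ha, hae⟩ := eventually_smul_one_le ((hc2.tendsto _).comp hΘ) hpos
      (Eventually.of_forall fun x => isHermitian_conjTranspose_mul_self _)
    refine ⟨a, ha, ?_⟩
    -- For `r ^ 2 < 1` the fast directions also satisfy the bound by `r ^ 2`, so `diag(r, 1)` loses
    -- no more than that.
    have hr1 : ∀ᶠ x in l, r x ^ 2 < 1 := by
      have : Tendsto (fun x => r x ^ 2) l (𝓝 (0 ^ 2)) := hr.pow 2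
      exact this.eventually_lt_const (by norm_num)
    filter_upwards [hae, hr1] with x hx hx1
    have hD : (r x ^ 2) • (1 : Matrix (ι ⊕ ι) (ι ⊕ ι) ℂ) ≤
        (fromBlocks ((r x : ℂ) • 1) 0 0 1)ᴴ * fromBlocks ((r x : ℂ) • 1) 0 0 1 := by
      have e : (fromBlocks ((r x : ℂ) • 1) 0 0 1)ᴴ * fromBlocks ((r x : ℂ) • 1) 0 0 1
          = (r x ^ 2) • (1 : Matrix (ι ⊕ ι) (ι ⊕ ι) ℂ) + (1 - r x ^ 2) •
            ((fromBlocks 0 0 0 1)ᴴ * fromBlocks 0 0 0 1 : Matrix (ι ⊕ ι) (ι ⊕ ι) ℂ) := by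
        rw [← fromBlocks_one]
        simp only [fromBlocks_conjTranspose, fromBlocks_multiply, fromBlocks_smul, fromBlocks_add]
        congr 1
        · simp [smul_smul, ← Complex.coe_smul, sq]
        · simp
        · simp
        · simp
      rw [e]
      exact le_add_of_nonneg_right (smul_nonneg (by linarith)
        (posSemidef_conjTranspose_mul_self _).nonneg)
    rw [conjTranspose_mul]
    calc (a * r x ^ 2) • (1 : Matrix (ι ⊕ ι) (ι ⊕ ι) ℂ) = r x ^ 2 • a • 1 := by
          rw [smul_smul, mul_comm]
      _ ≤ r x ^ 2 • ((slowFast J (W x) (V x) (r x))ᴴ * slowFast J (W x) (V x) (r x)) :=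
          smul_le_smul_of_nonneg_left hx (sq_nonneg _)
      _ ≤ _ := by
          refine (smul_conjTranspose_mul_self_le hD _).trans_eq ?_
          simp only [mul_assoc]
  · filter_upwards [hHh, hHW] with x hx hxW
    exact slowFast_lyapunov_identity hJ hx hK hbS.isHermitian hxW (r x) rfl rfl rfl

end FrequencyRegimes

/-! ### Pointwise consequences of a symbolic symmetrizer, and uniformity over directions -/

section Symmetrizer

variable {n d : ℕ} {ι : Type} [Fintype ι] [DecidableEq ι]
  {U : Set (RVec n)} {K S : RVec n → RVec d → Matrix ι ι ℂ}

theorem IsSymbolicSymmetrizer.posDef (h : IsSymbolicSymmetrizer U K S) {u : RVec n} (hu : u ∈ U)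
    {w : RVec d} (hw : w ≠ 0) : (S u w).PosDef := by
  obtain ⟨c, hc, h⟩ := h.uniformly_pos
  refine posDef_of_smul_one_le hc ?_
  simpa using h u hu w hw

theorem IsSymbolicSymmetrizer.continuousAt (h : IsSymbolicSymmetrizer U K S) (hU : IsOpen U)
    {u : RVec n} (hu : u ∈ U) {w : RVec d} (hw : w ≠ 0) : ContinuousAt (S u) w := by
  refine tendsto_pi_nhds.2 fun i => tendsto_pi_nhds.2 fun j => ?_
  have h1 : ContinuousAt (fun p : RVec n × RVec d => S p.1 p.2 i j) (u, w) :=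
    (h.smooth i j).continuousOn.continuousAt
      ((hU.prod isOpen_compl_singleton).mem_nhds ⟨hu, hw⟩)
  exact h1.comp (f := fun w : RVec d => (u, w)) (by fun_prop)

end Symmetrizer

/-- From the boundary `{0} × 𝕊` of the half line times the sphere to a uniform neighbourhood. -/
theorem exists_hasLyapunov_near_sphere {d : ℕ} {ι : Type*} [Fintype ι] [DecidableEq ι]
    {M : ℝ × RVec d → Matrix ι ι ℂ} {ρ : ℝ × RVec d → ℝ} (hρ : ∀ x, 0 ≤ ρ x)
    (h : ∀ w₀ : RVec d, ‖w₀‖ = 1 → ∃ κ : ℝ, 0 < κ ∧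
      ∀ᶠ x in 𝓝[{x | 0 < x.1 ∧ ‖x.2‖ = 1}] ((0 : ℝ), w₀), HasLyapunov κ (ρ x) (M x)) :
    ∃ κ : ℝ, 0 < κ ∧ ∃ δ : ℝ, 0 < δ ∧ ∀ r : ℝ, 0 < r → r < δ → ∀ w : RVec d, ‖w‖ = 1 →
      HasLyapunov κ (ρ (r, w)) (M (r, w)) := by
  have hs : IsCompact (Metric.sphere (0 : RVec d) 1) := isCompact_sphere 0 1
  obtain ⟨κ, hκ, hev⟩ := exists_hasLyapunov_of_isCompact
    (s := {(0 : ℝ)} ×ˢ Metric.sphere (0 : RVec d) 1)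
    (t := {x | 0 < x.1 ∧ ‖x.2‖ = 1}) (isCompact_singleton.prod hs) hρ (M := M) (by
      rintro ⟨r, w⟩ ⟨hr, hw⟩
      obtain rfl : r = 0 := hr
      obtain ⟨κ, hκ, h1⟩ := h w (by simpa using hw)
      exact ⟨κ, hκ, eventually_nhdsWithin_iff.1 h1⟩)
  -- The tube lemma: a neighbourhood of `{0}` times the sphere contains a uniform slab.
  rw [isCompact_singleton.nhdsSet_prod_eq hs, nhdsSet_singleton] at hev
  obtain ⟨p, hp, q, hq, hpq⟩ := eventually_prod_iff.1 hev
  obtain ⟨δ, hδ, hδp⟩ := Metric.eventually_nhds_iff.1 hp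
  refine ⟨κ, hκ, δ, hδ, fun r hr0 hr w hw => ?_⟩
  refine hpq (hδp (by simpa [abs_of_pos hr0] using hr)) ?_ ⟨hr0, hw⟩
  exact hq.self_of_nhdsSet w (by simpa using hw)

theorem posDef_of_smul_one_le_real {ι : Type*} [DecidableEq ι] {N : Matrix ι ι ℝ} {c : ℝ}
    (hc : 0 < c) (h : c • (1 : Matrix ι ι ℝ) ≤ N) : N.PosDef := by
  have h1 : (c • (1 : Matrix ι ι ℝ)).PosDef := PosDef.one.smul hc
  simpa using h1.add_posSemidef (Matrix.le_iff.1 h)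

/-! ### The Fourier symbol: continuity, homogeneity, rescaling -/

namespace QuasilinearSystem

variable {n d : ℕ} (P : QuasilinearSystem n d)

theorem continuous_symA (u : RVec n) : Continuous fun ξ : RVec d => P.symA u ξ := by
  refine continuous_matrix fun a b => ?_
  simp only [symA, toCMat, Matrix.map_apply, Matrix.sum_apply, Matrix.smul_apply]
  fun_prop

theorem continuous_symB (u : RVec n) : Continuous fun ξ : RVec d => P.symB u ξ := by
  refine continuous_matrix fun a b => ?_
  simp only [symB, toCMat, Matrix.map_apply, Matrix.sum_apply, Matrix.smul_apply]
  fun_prop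

theorem continuous_symC (u : RVec n) : Continuous fun ξ : RVec d => P.symC u ξ := by
  refine continuous_matrix fun a b => ?_
  simp only [symC, toCMat, Matrix.map_apply, Matrix.sum_apply, Matrix.smul_apply]
  fun_prop

theorem symA_smul (u : RVec n) (r : ℝ) (ξ : RVec d) :
    P.symA u (r • ξ) = (r : ℂ) • P.symA u ξ := by
  ext a b
  simp [symA, toCMat, Matrix.sum_apply, Finset.mul_sum, mul_assoc]

theorem symB_smul (u : RVec n) (r : ℝ) (ξ : RVec d) :
    P.symB u (r • ξ) = (r : ℂ) ^ 2 • P.symB u ξ := by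
  ext a b
  simp only [symB, toCMat, Matrix.map_apply, Matrix.sum_apply, Matrix.smul_apply, PiLp.smul_apply,
    smul_eq_mul, Complex.ofReal_sum, Complex.ofReal_mul, Finset.mul_sum]
  exact Finset.sum_congr rfl fun j _ => Finset.sum_congr rfl fun k _ => by ring

theorem symC_smul (u : RVec n) (r : ℝ) (ξ : RVec d) :
    P.symC u (r • ξ) = (r : ℂ) • P.symC u ξ := by
  ext a b
  simp [symC, toCMat, Matrix.sum_apply, Finset.mul_sum, mul_assoc, mul_add]

theorem dispersionMatrix_eq {u : RVec n} (hu : u ∈ P.U) (lam : ℂ) (ξ : RVec d) :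
    P.dispersionMatrix u lam ξ = lam ^ 2 • (1 : Matrix (Fin n) (Fin n) ℂ)
      + lam • (P.A0 u - Complex.I • P.symC u ξ) + Complex.I • P.symA u ξ + P.symB u ξ := by
  have hB : P.B 0 0 u = -1 := by rw [← P.B_zero_zero u hu, neg_neg]
  have h1 : toCMat (P.B 0 0 u) = -1 := by
    rw [hB]; ext a b; by_cases h : a = b <;> simp [toCMat, h]
  have hA' : P.symA u ξ = ∑ j : Fin d, (ξ j : ℂ) • toCMat (P.A j.succ u) := by
    ext a b; simp [symA, toCMat, Matrix.sum_apply]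
  have hB' : P.symB u ξ = ∑ j : Fin d, ∑ k : Fin d,
      ((ξ j : ℂ) * ξ k) • toCMat (P.B j.succ k.succ u) := by
    ext a b; simp [symB, toCMat, Matrix.sum_apply]
  have hC' : P.symC u ξ = ∑ j : Fin d, (ξ j : ℂ) • toCMat (P.B 0 j.succ u)
      + ∑ j : Fin d, (ξ j : ℂ) • toCMat (P.B j.succ 0 u) := by
    ext a b
    simp [symC, toCMat, Matrix.sum_apply, Finset.sum_add_distrib]
  rw [hA', hB', hC', dispersionMatrix]
  simp only [Fin.sum_univ_succ, freq, Fin.cons_zero, Fin.cons_succ, h1, A0,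
    Finset.sum_add_distrib, smul_sub, smul_add, Finset.smul_sum, smul_smul]
  have e1 : ∀ j k : Fin d, Complex.I * (ξ j : ℂ) * (Complex.I * ξ k) = -((ξ j : ℂ) * ξ k) := by
    intro j k; linear_combination ((ξ j : ℂ) * ξ k) * Complex.I_mul_I
  have e2 : ∀ j : Fin d, Complex.I * (ξ j : ℂ) * lam = lam * (Complex.I * ξ j) := by
    intro j; ring
  simp only [e1, e2, neg_smul, Finset.sum_neg_distrib]
  module

theorem calZ_mul (ξ : RVec d) : calZ n ξ * fromBlocks ((Real.sqrt (1 + ‖ξ‖ ^ 2) : ℂ)⁻¹ • 1) 0 0 1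
    = 1 := by
  have h : (Real.sqrt (1 + ‖ξ‖ ^ 2) : ℂ) ≠ 0 := by
    have : 0 < Real.sqrt (1 + ‖ξ‖ ^ 2) := by positivity
    exact_mod_cast this.ne'
  rw [calZ, fromBlocks_multiply, ← fromBlocks_one]
  congr 1
  · rw [zero_mul, add_zero, smul_mul_smul_comm, mul_inv_cancel₀ h, one_smul, one_mul]
  all_goals simp

theorem calZ_inv (ξ : RVec d) :
    (calZ n ξ)⁻¹ = fromBlocks ((Real.sqrt (1 + ‖ξ‖ ^ 2) : ℂ)⁻¹ • 1) 0 0 1 :=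
  Matrix.inv_eq_right_inv (calZ_mul ξ)

theorem calZ_inv_mul (ξ : RVec d) : (calZ n ξ)⁻¹ * calZ n ξ = 1 := by
  rw [calZ_inv]
  exact mul_eq_one_comm.1 (calZ_mul ξ)

theorem continuous_symM (u : RVec n) : Continuous fun ξ : RVec d => P.symM u ξ := by
  have h0 : ∀ ξ : RVec d, (Real.sqrt (1 + ‖ξ‖ ^ 2) : ℂ) ≠ 0 := fun ξ => by
    have : 0 < Real.sqrt (1 + ‖ξ‖ ^ 2) := by positivity
    exact_mod_cast this.ne'
  have hA := P.continuous_symA u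
  have hB := P.continuous_symB u
  have hC := P.continuous_symC u
  simp only [symM, calZ_inv]
  simp only [calZ, symMbar]
  have h1 : Continuous fun ξ : RVec d => (Real.sqrt (1 + ‖ξ‖ ^ 2) : ℂ) := by fun_prop
  have h2 := h1.inv₀ h0
  fun_prop

/-- Each regime has its natural scaling `diag(a, 1)`, with `a = 1` at low and `a = ‖ξ‖` at high
frequency. There `a` is comparable to ⟨ξ⟩ up to a factor √2, so passing to `calZ` costs only the
constant 1/2. -/
theorem hasLyapunov_symM {u : RVec n} {ξ : RVec d} {κ ρ a : ℝ}
    {N : Matrix (Fin n ⊕ Fin n) (Fin n ⊕ Fin n) ℂ} (hκ : 0 < κ) (hρ : 0 ≤ ρ)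
    (h1 : 1 + ‖ξ‖ ^ 2 ≤ 2 * a ^ 2) (h2 : a ^ 2 ≤ 1 + ‖ξ‖ ^ 2)
    (hN : fromBlocks ((a : ℂ) • 1) 0 0 1 * P.symMbar u ξ = N * fromBlocks ((a : ℂ) • 1) 0 0 1)
    (h : HasLyapunov κ ρ N) : HasLyapunov (κ * (1 / 2)) ρ (P.symM u ξ) := by
  have hp : 0 < 1 + ‖ξ‖ ^ 2 := by positivity
  have hS : fromBlocks ((a : ℂ) • 1) 0 0 1 * (calZ n ξ)⁻¹
      = fromBlocks (((a / Real.sqrt (1 + ‖ξ‖ ^ 2) : ℝ) : ℂ) • 1) 0 0 1 := by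
    rw [calZ_inv, fromBlocks_multiply]
    congr 1
    · rw [zero_mul, add_zero, smul_mul_smul_comm, one_mul, div_eq_mul_inv]
      push_cast
      rfl
    all_goals simp
  set q := a / Real.sqrt (1 + ‖ξ‖ ^ 2) with hq
  have hq2 : q ^ 2 = a ^ 2 / (1 + ‖ξ‖ ^ 2) := by rw [hq, div_pow, Real.sq_sqrt hp.le]
  have hq1 : 1 / 2 ≤ q ^ 2 := by rw [hq2, le_div_iff₀ hp]; linarith
  have hq1' : q ^ 2 ≤ 1 := by rw [hq2, div_le_iff₀ hp]; linarith
  have hSS : (fromBlocks ((q : ℂ) • 1) 0 0 1 : Matrix (Fin n ⊕ Fin n) (Fin n ⊕ Fin n) ℂ)ᴴ *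
      fromBlocks ((q : ℂ) • 1) 0 0 1 = diagonal (Sum.elim (fun _ => ((q ^ 2 : ℝ) : ℂ)) 1) := by
    rw [← fromBlocks_diagonal, fromBlocks_conjTranspose, fromBlocks_multiply]
    congr 1
    · ext i j; by_cases h : i = j <;> simp [h, sq]
    all_goals simp
  have hone : ∀ t : ℝ, t • (1 : Matrix (Fin n ⊕ Fin n) (Fin n ⊕ Fin n) ℂ)
      = diagonal (fun _ => (t : ℂ)) := fun t => by
    ext i j; by_cases h : i = j <;> simp [h]
  refine h.conj (S := fromBlocks ((q : ℂ) • 1) 0 0 1) hκ hρ (by norm_num) ?_ ?_ ?_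
  · rw [← hS, symM]
    calc _ = fromBlocks ((a : ℂ) • 1) 0 0 1 * ((calZ n ξ)⁻¹ * calZ n ξ) * P.symMbar u ξ *
          (calZ n ξ)⁻¹ := by simp only [mul_assoc]
      _ = _ := by rw [calZ_inv_mul, mul_one, hN, mul_assoc]
  · rw [hSS, hone, Matrix.le_iff, diagonal_sub, posSemidef_diagonal_iff]
    rintro (i | i)
    · simp only [Sum.elim_inl, ← Complex.ofReal_sub]
      exact_mod_cast sub_nonneg.2 hq1
    · simp only [Sum.elim_inr, Pi.one_apply, ← Complex.ofReal_one, ← Complex.ofReal_sub]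
      exact_mod_cast (by norm_num : (0 : ℝ) ≤ 1 - 1 / 2)
  · rw [hSS, ← diagonal_one, ← diagonal_smul, Matrix.le_iff, diagonal_sub, posSemidef_diagonal_iff]
    rintro (i | i)
    · simp only [Pi.smul_apply, Sum.elim_inl, Complex.real_smul, ← Complex.ofReal_one,
        ← Complex.ofReal_sub, ← Complex.ofReal_mul]
      exact_mod_cast (by linarith : (0 : ℝ) ≤ 1 - 1 / 2 * q ^ 2)
    · simp only [Pi.smul_apply, Sum.elim_inr, Complex.real_smul, Pi.one_apply,
        ← Complex.ofReal_one, ← Complex.ofReal_sub, ← Complex.ofReal_mul]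
      exact_mod_cast (by norm_num : (0 : ℝ) ≤ 1 - 1 / 2 * 1)

end QuasilinearSystem

/-! ### Application to the system and gluing of the regimes -/

namespace QuasilinearSystem

variable {n d : ℕ} (P : QuasilinearSystem n d)

/-- Up to conjugation by `calZ`, an eigenvector has the form (a, m a), and its first component lies
in the kernel of the dispersion matrix at λ = m. -/
theorem re_lt_zero_of_symM_mulVec {u : RVec n} (hu : u ∈ P.U) {ξ : RVec d}
    (hD : ∀ lam : ℂ, (P.dispersionMatrix u lam ξ).det = 0 → lam.re < 0)
    (m : ℂ) (v : Fin n ⊕ Fin n → ℂ) (hv : v ≠ 0) (h : P.symM u ξ *ᵥ v = m • v) : m.re < 0 := by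
  obtain ⟨a, b, hy⟩ : ∃ a b, (calZ n ξ)⁻¹ *ᵥ v = Sum.elim a b :=
    ⟨_, _, (Sum.elim_comp_inl_inr _).symm⟩
  have hZ : calZ n ξ * (calZ n ξ)⁻¹ = 1 := mul_eq_one_comm.1 (calZ_inv_mul ξ)
  have h1 : P.symMbar u ξ *ᵥ Sum.elim a b = m • Sum.elim a b := by
    rw [← hy, ← mulVec_smul, ← h, mulVec_mulVec, mulVec_mulVec, symM]
    simp only [← mul_assoc]
    rw [calZ_inv_mul, one_mul]
  rw [symMbar, fromBlocks_mulVec] at h1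
  simp only [Sum.elim_comp_inl, Sum.elim_comp_inr, zero_mulVec, one_mulVec, zero_add] at h1
  have hb : b = m • a := by
    ext i; simpa using congrFun h1 (Sum.inl i)
  have h2 : (-(Complex.I • P.symA u ξ) - P.symB u ξ) *ᵥ a
      + (Complex.I • P.symC u ξ - P.A0 u) *ᵥ b = m • b := by
    ext i; simpa using congrFun h1 (Sum.inr i)
  refine hD m (Matrix.exists_mulVec_eq_zero_iff.1 ⟨a, ?_, ?_⟩)
  · rintro rfl
    rw [smul_zero] at hb
    apply hv
    have h3 : (calZ n ξ)⁻¹ *ᵥ v = 0 := by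
      rw [hy, hb]; ext i; cases i <;> rfl
    rw [← one_mulVec v, ← hZ, ← mulVec_mulVec, h3, mulVec_zero]
  · rw [P.dispersionMatrix_eq hu]
    rw [hb] at h2
    simp only [add_mulVec, sub_mulVec, neg_mulVec, smul_mulVec, mulVec_smul, one_mulVec] at h2 ⊢
    linear_combination (norm := module) -h2

/-- The slow generator at second order, `W₁ = H * slowDiffusion`. -/
def slowDiffusion (u : RVec n) (w : RVec d) : Matrix (Fin n) (Fin n) ℂ :=
  (P.A0 u)⁻¹ * (-P.symB u w + (P.A0 u)⁻¹ * P.symA u w * (P.A0 u)⁻¹ * P.symA u w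
    + P.symC u w * (P.A0 u)⁻¹ * P.symA u w)

theorem continuous_W0 (u : RVec n) : Continuous fun w : RVec d => P.W0 u w := by
  have hA := P.continuous_symA u
  unfold W0
  fun_prop

theorem continuous_slowDiffusion (u : RVec n) :
    Continuous fun w : RVec d => P.slowDiffusion u w := by
  have hA := P.continuous_symA u
  have hB := P.continuous_symB u
  have hC := P.continuous_symC u
  unfold slowDiffusion
  fun_prop

theorem CondHA.exists_sigma_at {P : QuasilinearSystem n d}
    {H : RVec n → RVec d → Matrix (Fin n) (Fin n) ℂ} (hA : P.CondHA H) {u : RVec n}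
    (hu : u ∈ P.U) :
    ∃ S : Matrix (Fin n) (Fin n) ℂ, S.PosDef ∧ (S * P.A0 u).PosDef := by
  obtain ⟨Sig, -, -, -, ⟨c, hc, h1⟩, -, ⟨c', hc', h2⟩⟩ := hA.exists_sigma
  refine ⟨toCMat (Sig u), posDef_toCMat (posDef_of_smul_one_le_real hc (h1 u hu)), ?_⟩
  have e : toCMat (Sig u) * P.A0 u = toCMat (Sig u * P.A 0 u) := by
    ext i j; simp [toCMat, A0, Matrix.mul_apply]
  rw [e]
  exact posDef_toCMat (posDef_of_smul_one_le_real hc' (h2 u hu))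

/-- Solving the definition of `slowDiffusion` for B gives B = CW₀ + W₀² - A⁰V, the form in which the
slow subspace is explicit. -/
theorem symMbar_smul {u : RVec n} (h : (P.A0 u)⁻¹ * P.A0 u = 1) (r : ℝ) (w : RVec d) :
    P.symMbar u (r • w) = fromBlocks 0 1
        (-((r : ℂ) • (Complex.I • (P.A0 u * P.W0 u w))) - (r : ℂ) ^ 2 •
          (P.symC u w * P.W0 u w + P.W0 u w * P.W0 u w - P.A0 u * P.slowDiffusion u w))
        ((r : ℂ) • (Complex.I • P.symC u w) - P.A0 u) := by
  have h' : P.A0 u * (P.A0 u)⁻¹ = 1 := mul_eq_one_comm.1 h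
  have e1 : P.A0 u * P.W0 u w = P.symA u w := by rw [W0, ← mul_assoc, h', one_mul]
  have e2 : P.symC u w * P.W0 u w + P.W0 u w * P.W0 u w - P.A0 u * P.slowDiffusion u w
      = P.symB u w := by
    rw [slowDiffusion, ← mul_assoc (P.A0 u), h', one_mul, W0]
    noncomm_ring
  rw [e1, e2, symMbar, symA_smul, symB_smul, symC_smul, smul_comm (r : ℂ) Complex.I,
    smul_comm (r : ℂ) Complex.I]

theorem exists_hasLyapunov_low {H : RVec n → RVec d → Matrix (Fin n) (Fin n) ℂ}
    {HH : RVec n → RVec d → Matrix (Fin n ⊕ Fin n) (Fin n ⊕ Fin n) ℂ} {u : RVec n}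
    (hu : u ∈ P.U) (hA : P.CondHA H) (hD : P.CondD H HH u) :
    ∃ κ : ℝ, 0 < κ ∧ ∃ δ : ℝ, 0 < δ ∧ ∀ ξ : RVec d, ξ ≠ 0 → ‖ξ‖ < δ →
      HasLyapunov κ (‖ξ‖ ^ 2) (P.symM u ξ) := by
  obtain ⟨S, hS, hSA⟩ := hA.exists_sigma_at hu
  have hJ : (P.A0 u)⁻¹ * P.A0 u = 1 := by
    refine Matrix.nonsing_inv_mul _ ?_
    have := (Matrix.isUnit_iff_isUnit_det _).1 hSA.isUnit
    rw [det_mul] at this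
    exact isUnit_of_mul_isUnit_right this
  obtain ⟨c, hc, hD1⟩ := hD.D1
  have hHW : ∀ w : RVec d, w ≠ 0 → (H u w * P.W0 u w).IsHermitian := fun w hw =>
    hA.symmetrizer.symmetrizes u hu w hw
  obtain ⟨κ, hκ, δ, hδ, h⟩ := exists_hasLyapunov_near_sphere (d := d)
    (M := fun x => P.symMbar u (x.1 • x.2)) (ρ := fun x => x.1 ^ 2) (fun x => sq_nonneg _) (by
      intro w₀ hw₀
      have hw₀0 : w₀ ≠ 0 := by rintro rfl; simp at hw₀
      have hne : ∀ᶠ x : ℝ × RVec d in 𝓝[{x | 0 < x.1 ∧ ‖x.2‖ = 1}] ((0 : ℝ), w₀), x.2 ≠ 0 := by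
        filter_upwards [self_mem_nhdsWithin] with x hx h0
        have := hx.2
        simp [h0] at this
      have hsnd : Tendsto (fun x : ℝ × RVec d => x.2)
          (𝓝[{x | 0 < x.1 ∧ ‖x.2‖ = 1}] ((0 : ℝ), w₀)) (𝓝 w₀) :=
        (continuous_snd.tendsto ((0 : ℝ), w₀)).mono_left nhdsWithin_le_nhds
      have hfst : Tendsto (fun x : ℝ × RVec d => x.1)
          (𝓝[{x | 0 < x.1 ∧ ‖x.2‖ = 1}] ((0 : ℝ), w₀)) (𝓝 0) :=
        (continuous_fst.tendsto ((0 : ℝ), w₀)).mono_left nhdsWithin_le_nhds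
      simp only [P.symMbar_smul hJ]
      have hC := ((P.continuous_symC u).tendsto w₀).comp hsnd
      have hW := ((P.continuous_W0 u).tendsto w₀).comp hsnd
      have hV := ((P.continuous_slowDiffusion u).tendsto w₀).comp hsnd
      have hH := (hA.symmetrizer.continuousAt P.isOpen_U hu hw₀0).tendsto.comp hsnd
      simp only [Function.comp_def] at hC hW hV hH
      refine eventually_hasLyapunov_low hJ hS hSA hfst hC hW hV hH
        (hA.symmetrizer.posDef hu hw₀0)
        (hne.mono fun x hx => hA.symmetrizer.hermitian u hu x.2 hx) (hHW w₀ hw₀0)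
        (hne.mono fun x hx => hHW x.2 hx) hc ?_
      have := hD1 w₀ hw₀
      rwa [W1, mul_assoc] at this)
  -- The bound `‖ξ‖ < 1` keeps ⟨ξ⟩² below 2, as the scaling `a = 1` needs.
  refine ⟨κ * (1 / 2), by positivity, min δ 1, by positivity, fun ξ hξ hξδ => ?_⟩
  have hpos : 0 < ‖ξ‖ := norm_pos_iff.2 hξ
  have h1 := h ‖ξ‖ hpos (hξδ.trans_le (min_le_left _ _)) (‖ξ‖⁻¹ • ξ)
    (by rw [norm_smul, norm_inv, norm_norm, inv_mul_cancel₀ hpos.ne'])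
  simp only [smul_inv_smul₀ hpos.ne'] at h1
  have hξ1 : ‖ξ‖ < 1 := hξδ.trans_le (min_le_right _ _)
  refine P.hasLyapunov_symM (a := 1) hκ (sq_nonneg _) (by nlinarith) (by nlinarith) ?_ h1
  simp

theorem hasLyapunov_zero {H : RVec n → RVec d → Matrix (Fin n) (Fin n) ℂ} {u : RVec n}
    (hu : u ∈ P.U) (hA : P.CondHA H) :
    ∃ κ : ℝ, 0 < κ ∧ HasLyapunov κ 0 (P.symM u (0 : RVec d)) := by
  obtain ⟨S, hS, hSA⟩ := hA.exists_sigma_at hu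
  have hJ : (P.A0 u)⁻¹ * P.A0 u = 1 := by
    refine Matrix.nonsing_inv_mul _ ?_
    have := (Matrix.isUnit_iff_isUnit_det _).1 hSA.isUnit
    rw [det_mul] at this
    exact isUnit_of_mul_isUnit_right this
  -- At ξ = 0 only A⁰ remains, so the low-frequency result is used at `r = 0` itself, with dummy
  -- slow data; `V = -1` makes the negativity condition hold trivially.
  obtain ⟨κ, hκ, h⟩ := eventually_hasLyapunov_low (l := (pure () : Filter Unit)) (r := fun _ => 0)
    (C := fun _ => 0) (W := fun _ => 0) (V := fun _ => -1) (H := fun _ => 1) hJ hS hSA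
    tendsto_const_nhds tendsto_const_nhds tendsto_const_nhds tendsto_const_nhds tendsto_const_nhds
    PosDef.one (by simp) (by simp) (by simp) (c := 1) one_pos (by
      intro m v _
      have h0 : 0 ≤ (star v ⬝ᵥ v).re := (Complex.le_def.1 (dotProduct_star_self_nonneg v)).1
      simp [add_mulVec, neg_mulVec]
      linarith)
  refine ⟨κ * (1 / 2), by positivity, ?_⟩
  refine P.hasLyapunov_symM (a := 1) hκ le_rfl (by simp) (by simp) ?_ (by simpa using h)
  have hA0 : P.symA u (0 : RVec d) = 0 := by simpa using P.symA_smul u 0 (0 : RVec d)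
  have hB0 : P.symB u (0 : RVec d) = 0 := by simpa using P.symB_smul u 0 (0 : RVec d)
  have hC0 : P.symC u (0 : RVec d) = 0 := by simpa using P.symC_smul u 0 (0 : RVec d)
  simp [symMbar, hA0, hB0, hC0]

theorem scaled_symMbar (u : RVec n) {r : ℝ} (hr : 0 < r) {w : RVec d} (hw : ‖w‖ = 1) :
    fromBlocks ((r : ℂ) • 1) 0 0 1 * P.symMbar u (r • w)
      = ((r : ℂ) • P.calB u w + P.calA u w) * fromBlocks ((r : ℂ) • 1) 0 0 1 := by
  have hr' : (r : ℂ) ≠ 0 := by exact_mod_cast hr.ne'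
  simp only [symMbar, calB, calA, hw, symA_smul, symB_smul, symC_smul, fromBlocks_smul,
    fromBlocks_add, fromBlocks_multiply]
  congr 1
  · simp
  · simp
  · simp only [Complex.ofReal_one, inv_one, one_smul, one_mul, zero_add, mul_zero,
      add_zero, mul_smul_comm, mul_one]
    module
  · simp only [mul_zero, mul_one, one_mul, zero_add]
    module

theorem continuous_calA (u : RVec n) : Continuous fun w : RVec d => P.calA u w := by
  have hA := P.continuous_symA u
  unfold calA
  fun_prop

theorem continuousAt_calB (u : RVec n) {w : RVec d} (hw : w ≠ 0) :
    ContinuousAt (fun w : RVec d => P.calB u w) w := by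
  have hB := (P.continuous_symB u).continuousAt (x := w)
  have hC := (P.continuous_symC u).continuousAt (x := w)
  have h1 : ContinuousAt (fun w : RVec d => (‖w‖ : ℂ)) w := by fun_prop
  have h2 := h1.inv₀ (by simpa using hw)
  have hc : Continuous fun p : ℂ × ℂ × Matrix (Fin n) (Fin n) ℂ × Matrix (Fin n) (Fin n) ℂ =>
      (fromBlocks 0 (p.1 • 1) (-(p.2.1 • p.2.2.1)) (Complex.I • p.2.2.2) :
        Matrix (Fin n ⊕ Fin n) (Fin n ⊕ Fin n) ℂ) := by fun_prop
  have := hc.continuousAt.comp (h1.prodMk (h2.prodMk (hB.prodMk hC)))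
  simp only [Function.comp_def] at this
  exact this

theorem exists_hasLyapunov_high {H : RVec n → RVec d → Matrix (Fin n) (Fin n) ℂ}
    {HH : RVec n → RVec d → Matrix (Fin n ⊕ Fin n) (Fin n ⊕ Fin n) ℂ} {u : RVec n}
    (hu : u ∈ P.U) (hB : P.CondHB HH) (hD : P.CondD H HH u) :
    ∃ κ : ℝ, 0 < κ ∧ ∃ R : ℝ, ∀ ξ : RVec d, R < ‖ξ‖ → HasLyapunov κ 1 (P.symM u ξ) := by
  obtain ⟨c, hc, hD2⟩ := hD.D2
  have hB' : IsSymbolicSymmetrizer P.U (fun u ξ => Complex.I • P.calB u ξ) HH := hB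
  obtain ⟨κ, hκ, δ, hδ, h⟩ := exists_hasLyapunov_near_sphere (d := d)
    (M := fun x => ((x.1)⁻¹ : ℂ) • P.calB u x.2 + P.calA u x.2) (ρ := fun _ => 1)
    (fun _ => zero_le_one) (by
      intro w₀ hw₀
      have hw₀0 : w₀ ≠ 0 := by rintro rfl; simp at hw₀
      have hne : ∀ᶠ x : ℝ × RVec d in 𝓝[{x | 0 < x.1 ∧ ‖x.2‖ = 1}] ((0 : ℝ), w₀), x.2 ≠ 0 := by
        filter_upwards [self_mem_nhdsWithin] with x hx h0
        have := hx.2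
        simp [h0] at this
      have hsnd : Tendsto (fun x : ℝ × RVec d => x.2)
          (𝓝[{x | 0 < x.1 ∧ ‖x.2‖ = 1}] ((0 : ℝ), w₀)) (𝓝 w₀) :=
        (continuous_snd.tendsto ((0 : ℝ), w₀)).mono_left nhdsWithin_le_nhds
      have hfst : Tendsto (fun x : ℝ × RVec d => x.1)
          (𝓝[{x | 0 < x.1 ∧ ‖x.2‖ = 1}] ((0 : ℝ), w₀)) (𝓝 0) :=
        (continuous_fst.tendsto ((0 : ℝ), w₀)).mono_left nhdsWithin_le_nhds
      have hH := (hB'.continuousAt P.isOpen_U hu hw₀0).tendsto.comp hsnd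
      have hBt := (P.continuousAt_calB u hw₀0).tendsto.comp hsnd
      have hAt := ((P.continuous_calA u).tendsto w₀).comp hsnd
      simp only [Function.comp_def] at hH hBt hAt
      exact eventually_hasLyapunov_high hfst
        (by filter_upwards [self_mem_nhdsWithin] with x hx using hx.1) hH hBt hAt
        (hB'.posDef hu hw₀0) (hne.mono fun x hx => hB'.hermitian u hu x.2 hx)
        (hB'.symmetrizes u hu w₀ hw₀0) (hne.mono fun x hx => hB'.symmetrizes u hu x.2 hx)
        hc (hD2 w₀ hw₀))
  -- The small parameter is `‖ξ‖⁻¹`, hence the threshold `δ⁻¹`; `‖ξ‖ > 1` gives ⟨ξ⟩² ≤ 2‖ξ‖².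
  refine ⟨κ * (1 / 2), by positivity, max δ⁻¹ 1, fun ξ hξ => ?_⟩
  have hξ1 : 1 < ‖ξ‖ := (le_max_right _ _).trans_lt hξ
  have hpos : 0 < ‖ξ‖ := by linarith
  have hw : ‖‖ξ‖⁻¹ • ξ‖ = 1 := by rw [norm_smul, norm_inv, norm_norm, inv_mul_cancel₀ hpos.ne']
  have h1 := h ‖ξ‖⁻¹ (by positivity) (inv_lt_of_inv_lt₀ hδ ((le_max_left _ _).trans_lt hξ))
    (‖ξ‖⁻¹ • ξ) hw
  have h2 := P.scaled_symMbar u hpos hw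
  rw [smul_inv_smul₀ hpos.ne'] at h2
  refine P.hasLyapunov_symM (a := ‖ξ‖) hκ zero_le_one (by nlinarith) (by linarith) h2 ?_
  simpa using h1

theorem exists_hasLyapunov_middle {H : RVec n → RVec d → Matrix (Fin n) (Fin n) ℂ}
    {HH : RVec n → RVec d → Matrix (Fin n ⊕ Fin n) (Fin n ⊕ Fin n) ℂ} {u : RVec n}
    (hu : u ∈ P.U) (hD : P.CondD H HH u) {δ : ℝ} (hδ : 0 < δ) (R : ℝ) :
    ∃ κ : ℝ, 0 < κ ∧ ∀ ξ : RVec d, δ ≤ ‖ξ‖ → ‖ξ‖ ≤ R → HasLyapunov κ 1 (P.symM u ξ) := by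
  have hs : IsCompact {ξ : RVec d | δ ≤ ‖ξ‖ ∧ ‖ξ‖ ≤ R} := by
    refine (isCompact_closedBall (0 : RVec d) R).of_isClosed_subset ?_ fun ξ hξ => by
      simpa using hξ.2
    exact (isClosed_le continuous_const continuous_norm).inter
      (isClosed_le continuous_norm continuous_const)
  obtain ⟨κ, hκ, h⟩ := exists_hasLyapunov_of_isCompact hs (t := Set.univ) (ρ := fun _ => 1)
    (M := fun ξ => P.symM u ξ) (fun _ => zero_le_one) (by
      intro ξ hξ
      have hξ0 : ξ ≠ 0 := by
        rintro rfl
        have := hξ.1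
        rw [norm_zero] at this
        linarith
      obtain ⟨κ, hκ, h⟩ := eventually_hasLyapunov_of_stable ((P.continuous_symM u).tendsto ξ)
        (P.re_lt_zero_of_symM_mulVec hu fun lam => hD.D3 lam ξ hξ0)
      exact ⟨κ, hκ, h.mono fun x hx _ => hx⟩)
  exact ⟨κ, hκ, fun ξ h1 h2 => h.self_of_nhdsSet ξ ⟨h1, h2⟩ trivial⟩

theorem exists_hasLyapunov {H : RVec n → RVec d → Matrix (Fin n) (Fin n) ℂ}
    {HH : RVec n → RVec d → Matrix (Fin n ⊕ Fin n) (Fin n ⊕ Fin n) ℂ} {u : RVec n}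
    (hu : u ∈ P.U) (hA : P.CondHA H) (hB : P.CondHB HH) (hD : P.CondD H HH u) :
    ∃ κ : ℝ, 0 < κ ∧ ∀ ξ : RVec d,
      HasLyapunov κ (‖ξ‖ ^ 2 / (1 + ‖ξ‖ ^ 2)) (P.symM u ξ) := by
  obtain ⟨κ₁, hκ₁, δ, hδ, h₁⟩ := P.exists_hasLyapunov_low hu hA hD
  obtain ⟨κ₂, hκ₂, R, h₂⟩ := P.exists_hasLyapunov_high hu hB hD
  obtain ⟨κ₃, hκ₃, h₃⟩ := P.exists_hasLyapunov_middle hu hD hδ R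
  obtain ⟨κ₀, hκ₀, h₀⟩ := P.hasLyapunov_zero hu hA
  refine ⟨min (min κ₀ κ₁) (min κ₂ κ₃), by positivity, fun ξ => ?_⟩
  have hρ : 0 ≤ ‖ξ‖ ^ 2 / (1 + ‖ξ‖ ^ 2) := by positivity
  -- The common rate is dominated both by 1 and by `‖ξ‖ ^ 2`, the rates of the separate regimes.
  have hρ1 : ‖ξ‖ ^ 2 / (1 + ‖ξ‖ ^ 2) ≤ 1 := by
    rw [div_le_one (by positivity)]; linarith
  have hρ2 : ‖ξ‖ ^ 2 / (1 + ‖ξ‖ ^ 2) ≤ ‖ξ‖ ^ 2 :=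
    div_le_self (sq_nonneg _) (by nlinarith [sq_nonneg ‖ξ‖])
  by_cases hξ : ξ = 0
  · subst hξ
    refine HasLyapunov.mono (κ := κ₀) ?_ (by positivity)
      ((min_le_left _ _).trans (min_le_left _ _)) hρ
    simpa using h₀
  by_cases hlow : ‖ξ‖ < δ
  · exact ((h₁ ξ hξ hlow).mono_rate hκ₁.le hρ2).mono (by positivity)
      ((min_le_left _ _).trans (min_le_right _ _)) hρ
  by_cases hhigh : R < ‖ξ‖
  · exact ((h₂ ξ hhigh).mono_rate hκ₂.le hρ1).mono (by positivity)
      ((min_le_right _ _).trans (min_le_left _ _)) hρ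
  · exact ((h₃ ξ (not_lt.1 hlow) (not_lt.1 hhigh)).mono_rate hκ₃.le hρ1).mono (by positivity)
      ((min_le_right _ _).trans (min_le_right _ _)) hρ

end QuasilinearSystem

end

theorem proposition3p4 {n d : ℕ} (P : QuasilinearSystem n d)
    (H : RVec n → RVec d → Matrix (Fin n) (Fin n) ℂ)
    (HH : RVec n → RVec d → Matrix (Fin n ⊕ Fin n) (Fin n ⊕ Fin n) ℂ)
    (ubar : RVec n) (hubar : ubar ∈ P.U)
    (hA : P.CondHA H) (hB : P.CondHB HH) (hD : P.CondD H HH ubar) :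
    ∃ c : ℝ, 0 < c ∧ ∃ T : RVec d → Matrix (Fin n ⊕ Fin n) (Fin n ⊕ Fin n) ℂ,
      (∀ ξ, IsUnit (T ξ)) ∧
      (∃ K : ℝ, ∀ ξ, ∀ i j, ‖T ξ i j‖ ≤ K ∧ ‖(T ξ)⁻¹ i j‖ ≤ K) ∧
      ∀ ξ : RVec d,
        T ξ * P.symM ubar ξ * (T ξ)⁻¹ + (T ξ * P.symM ubar ξ * (T ξ)⁻¹)ᴴ
          ≤ ((-c * (‖ξ‖ ^ 2 / (1 + ‖ξ‖ ^ 2)) : ℝ) : ℂ) •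
              (1 : Matrix (Fin n ⊕ Fin n) (Fin n ⊕ Fin n) ℂ) := by
  obtain ⟨κ, hκ, h⟩ := P.exists_hasLyapunov hubar hA hB hD
  choose T hT hTb hTd using fun ξ => (h ξ).exists_conj hκ (by positivity)
  refine ⟨κ * κ, by positivity, T, hT, ⟨_, hTb⟩, fun ξ => (hTd ξ).trans_eq ?_⟩
  rw [Complex.coe_smul, ← neg_smul, neg_mul]
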